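/- Let $V$ be a finite-dimensional real vector space with a scalar product $\langle\cdot,\cdot\rangle$ (a nondegenerate symmetric bilinear form of arbitrary signature) and let $k\ge 0$. An *algebraic curvature tensor* is a tensor $R\in\otimes^4V^*$ with $R(x_1,x_2,y_1,y_2)=-R(x_2,x_1,y_1,y_2)=R(y_1,y_2,x_1,x_2)$ and $R(x_1,x_2,x_3,y)+R(x_2,x_3,x_1,y)+R(x_3,x_1,x_2,y)=0$. An *algebraic curvature $k$-jet* is a sequence $(R,\nabla R,\dots,\nabla^{k)}R)$ with $\nabla^{l)}R\in\otimes^{l+4}V^*$, written $\nabla^{l)}_{x_1,\dots,x_l}R(y_1,y_2,y_3,y_4)$, such that 1. for all $0\le l\le k$ and $x_1,\dots,x_l\in V$, $\nabla^{l)}_{x_1,\dots,x_l}R$ is an algebraic curvature tensor; 2. (second Bianchi identity) for all $1\le l\le k$, the cyclic sum of $\nabla^{l)}_{x_1,\dots,x_{l-1},u_1}R(u_2,u_3,y_1,y_2)$ over $u_1,u_2,u_3$ vanishes; 3. (Ricci identities) for all $s,m\ge0$ with $s+m+2\le k$ and all $a_1,\dots,a_s,x,y,c_1,\dots,c_m\in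 V$, $$\nabla^{s+m+2)}_{a_1,\dots,a_s,x,y,c_1,\dots,c_m}R-\nabla^{s+m+2)}_{a_1,\dots,a_s,y,x,c_1,\dots,c_m}R=\sum_{P\sqcup Q=\{1,\dots,s\}}\Big(\big(\nabla^{|P|)}_{a_P}R\big)(x,y)\cdot\big(\nabla^{|Q|+m)}_{a_Q,\,\cdot\,,\dots,\,\cdot\,}R\big)\Big)_{c_1,\dots,c_m}.$$ Here $a_P$, $a_Q$ denote the subsequences of $(a_1,\dots,a_s)$ indexed by $P$, $Q$ in increasing order; $(\nabla^{|P|)}_{a_P}R)(x,y)$ is the endomorphism of $V$ with $\langle(\nabla^{|P|)}_{a_P}R)(x,y)u,w\rangle=\nabla^{|P|)}_{a_P}R(x,y,u,w)$; and an endomorphism $A$ acts on a covariant tensor by $(A\cdot T)(v_1,\dots,v_r)=-\sum_iT(v_1,\dots,Av_i,\dots,v_r)$, here on the $(m+4)$-tensor obtained from $\nabla^{|Q|+m)}R$ by fixing its first $|Q|$ arguments $a_Q$. Then every algebraic curvature $k$-jet comes from a metric: there are an open neighborhood $U\subseteq V$ of $0$, star-shaped with respect to $0$, and a smooth pseudo-Riemannian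 metric $g$ on $U$ with $g_0=\langle\cdot,\cdot\rangle$, given in normal coordinates (the straight lines $t\mapsto t\xi$, $t\in[0,1]$, $\xi\in U$, are geodesics), such that for all $0\le l\le k$ the $l$-fold iterated covariant derivative at the origin of the curvature tensor $R(u,v,w,z)=g(\nabla_u\nabla_vw-\nabla_v\nabla_uw-\nabla_{[u,v]}w,z)$ of $g$, with respect to the Levi-Civita connection of $g$ and with the slot of the last differentiation written first, is the given $\nabla^{l)}R$. -/

import Mathlib

/- Throughout, `V` is a finite-dimensional real vector space.  The norm on `V` is auxiliary: it only
provides the (unique) vector space topology, for which all linear maps are continuous.  The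
`(l + 4)`-fold covariant tensors on `V` are regarded as `l`-fold multilinear maps with values in the
four-fold covariant tensors. -/

noncomputable section

namespace CurvatureJet

variable {V : Type*} [NormedAddCommGroup V] [NormedSpace ℝ V]

/-- A (possibly indefinite) scalar product: a symmetric nondegenerate bilinear form. -/
structure IsScalarProduct (b : V →L[ℝ] V →L[ℝ] ℝ) : Prop where
  symm : ∀ x y, b x y = b y x
  nondegenerate : ∀ x, (∀ y, b x y = 0) → x = 0

/-- A real function of finitely many vectors `[x₁, …, x_l]` (the derivative slots) and of four
further vectors (the curvature slots). -/
abbrev ListTensor (V : Type*) := List V → V → V → V → V → ℝ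

/-- The usual derivation `A · T` of a covariant tensor by an endomorphism `A`:
`(A · T)(v₁, …, v_m) = - ∑ᵢ T(v₁, …, A vᵢ, …, v_m)`, summed over all derivative and curvature
slots. -/
def act (A : V → V) : ListTensor V → ListTensor V
  | T, [], y₁, y₂, y₃, y₄ =>
      -(T [] (A y₁) y₂ y₃ y₄ + T [] y₁ (A y₂) y₃ y₄ + T [] y₁ y₂ (A y₃) y₄ + T [] y₁ y₂ y₃ (A y₄))
  | T, b :: c, y₁, y₂, y₃, y₄ =>
      -T (A b :: c) y₁ y₂ y₃ y₄ + act A (fun Q => T (b :: Q)) c y₁ y₂ y₃ y₄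

/-- The formal Leibniz expansion of `∇^s_{a₁, …, a_s} (A · T)`, where `A P` stands for `∇_P A` and
`T (Q ++ c)` for `(∇_Q T) c`.  The directions in `Q` are not acted upon by `A`. In other words, this
is the sum over all ways to split `a₁, …, a_s` into two subsequences `P`, `Q` of
`(∇_P A) · (∇_Q T)`, evaluated on `c, y₁, …, y₄`. -/
def leibniz : (List V → V → V) → ListTensor V → List V → ListTensor V
  | A, T, [], c, y₁, y₂, y₃, y₄ => act (A []) T c y₁ y₂ y₃ y₄
  | A, T, a :: as, c, y₁, y₂, y₃, y₄ =>
      leibniz (fun P => A (a :: P)) T as c y₁ y₂ y₃ y₄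
        + leibniz A (fun Q => T (a :: Q)) as c y₁ y₂ y₃ y₄

/-! ### Algebraic curvature jets -/

/-- The algebraic identities of a curvature tensor. -/
structure IsAlgCurvature (R : V → V → V → V → ℝ) : Prop where
  skew : ∀ x₁ x₂ y₁ y₂, R x₁ x₂ y₁ y₂ = -R x₂ x₁ y₁ y₂
  pair_symm : ∀ x₁ x₂ y₁ y₂, R x₁ x₂ y₁ y₂ = R y₁ y₂ x₁ x₂
  bianchi₁ : ∀ x₁ x₂ x₃ y, R x₁ x₂ x₃ y + R x₂ x₃ x₁ y + R x₃ x₁ x₂ y = 0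

/-- The algebraic identities of a covariant derivative of a curvature tensor. -/
structure IsAlgCovDerivative (DR : V → V → V → V → V → ℝ) : Prop where
  curvature : ∀ x, IsAlgCurvature (DR x)
  bianchi₂ : ∀ x₁ x₂ x₃ y₁ y₂, DR x₁ x₂ x₃ y₁ y₂ + DR x₂ x₃ x₁ y₁ y₂ + DR x₃ x₁ x₂ y₁ y₂ = 0

/-- A sequence `∇^l R`, `l = 0, 1, 2, …`, of `(l + 4)`-fold covariant tensors; in a `k`-jet only the
members with `l ≤ k` are considered. -/
abbrev TensorSeq (V : Type*) [NormedAddCommGroup V] [NormedSpace ℝ V] :=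
  (l : ℕ) → MultilinearMap ℝ (fun _ : Fin l => V) (V →ₗ[ℝ] V →ₗ[ℝ] V →ₗ[ℝ] V →ₗ[ℝ] ℝ)

/-- `J.eval [x₁, …, x_l] y₁ y₂ y₃ y₄ = ∇^l_{x₁, …, x_l} R (y₁, y₂, y₃, y₄)`. -/
def TensorSeq.eval (J : TensorSeq V) (a : List V) : V →ₗ[ℝ] V →ₗ[ℝ] V →ₗ[ℝ] V →ₗ[ℝ] ℝ :=
  J a.length a.get

/-- `J.eval` as a plain function. -/
def TensorSeq.toListTensor (J : TensorSeq V) : ListTensor V :=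
  fun a y₁ y₂ y₃ y₄ => J.eval a y₁ y₂ y₃ y₄

/-- The endomorphism `(∇_P R)(x, y)` of `V`, i.e. the one with
`⟪(∇_P R)(x, y) u, w⟫ = ∇_P R (x, y, u, w)` for the scalar product `g₀`; `g₀.inverse` is the
inverse of the isomorphism `g₀ : V → V*`. -/
def curvatureEndo [FiniteDimensional ℝ V] (g₀ : V →L[ℝ] V →L[ℝ] ℝ) (J : TensorSeq V)
    (x y : V) (P : List V) (u : V) : V :=
  g₀.inverse (LinearMap.toContinuousLinearMap (J.eval P x y u))

/-- Algebraic curvature `k`-jets `(R, ∇R, …, ∇^k R)` on `(V, g₀)`. -/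
structure IsAlgCurvatureJet [FiniteDimensional ℝ V] (g₀ : V →L[ℝ] V →L[ℝ] ℝ) (k : ℕ)
    (J : TensorSeq V) : Prop where
  /-- `∇^l_{x₁, …, x_l} R` is an algebraic curvature tensor for `l ≤ k`. -/
  curvature : ∀ a : List V, a.length ≤ k → IsAlgCurvature (J.toListTensor a)
  /-- `∇^l_{x₁, …, x_{l-1}, ·} R` is an algebraic covariant derivative of a curvature tensor
  for `1 ≤ l ≤ k`. -/
  covDerivative : ∀ a : List V, a.length + 1 ≤ k →
    IsAlgCovDerivative (fun x => J.toListTensor (a ++ [x]))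
  /-- The Ricci identity `∇²_{x, y} T - ∇²_{y, x} T = R(x, y) · T` for `T = R, ∇R, …`, and all its
  formal covariant derivatives:
  `∇^l_{a, x, y, c} R - ∇^l_{a, y, x, c} R = (∇^s_a (R(x, y) · ∇^{l-s-2} R))_c`, `s = |a|`. -/
  ricci : ∀ (a : List V) (x y : V) (c : List V), a.length + c.length + 2 ≤ k →
    ∀ y₁ y₂ y₃ y₄ : V,
      J.toListTensor (a ++ x :: y :: c) y₁ y₂ y₃ y₄ - J.toListTensor (a ++ y :: x :: c) y₁ y₂ y₃ y₄
        = leibniz (curvatureEndo g₀ J x y) J.toListTensor a c y₁ y₂ y₃ y₄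

/-! ### Pseudo-Riemannian metrics on open subsets of `V` and their curvature -/

/-- `g` is a smooth pseudo-Riemannian metric on the open set `U`. -/
structure IsMetricOn (g : V → V →L[ℝ] V →L[ℝ] ℝ) (U : Set V) : Prop where
  smooth : ContDiffOn ℝ ((⊤ : ℕ∞) : WithTop ℕ∞) g U
  scalarProduct : ∀ p ∈ U, IsScalarProduct (g p)

/-- The Christoffel symbols `Γ_p(u, v)` of the Levi-Civita connection of `g`, i.e. `∇_u v` at `p`
for constant vector fields `u, v`, by Koszul's formula
`g_p(Γ_p(u, v), w) = (Dg_p(u)(v, w) + Dg_p(v)(u, w) - Dg_p(w)(u, v)) / 2`. -/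
def christoffel (g : V → V →L[ℝ] V →L[ℝ] ℝ) (p u v : V) : V :=
  (g p).inverse ((1 / 2 : ℝ) •
    (fderiv ℝ g p u v + fderiv ℝ g p v u - ((fderiv ℝ g p).flip u).flip v))

/-- The curvature tensor `R(u, v, w, z) = g(∇_u ∇_v w - ∇_v ∇_u w - ∇_[u, v] w, z)` at `p`. -/
def riemann (g : V → V →L[ℝ] V →L[ℝ] ℝ) (p u v w z : V) : ℝ :=
  g p (fderiv ℝ (fun q => christoffel g q v w) p u - fderiv ℝ (fun q => christoffel g q u w) p v
    + christoffel g p u (christoffel g p v w) - christoffel g p v (christoffel g p u w)) z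

/-- The covariant derivative of a tensor field `T`, the new slot being the first one:
`(∇_a T)(c, y₁, …, y₄) = ∂_a (T(c, y₁, …, y₄)) + (Γ(a, ·) · T)(c, y₁, …, y₄)`, that is, the
directional derivative minus the sum of all `T(…, Γ(a, v), …)`. -/
def covDeriv (g : V → V →L[ℝ] V →L[ℝ] ℝ) (T : V → ListTensor V) : V → ListTensor V
  | _, [], _, _, _, _ => 0
  | p, a :: c, y₁, y₂, y₃, y₄ =>
      fderiv ℝ (fun q => T q c y₁ y₂ y₃ y₄) p a + act (christoffel g p a) (T p) c y₁ y₂ y₃ y₄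

/-- The iterated covariant derivative `∇^l R` of the curvature tensor of `g`: the value at the point
`p` is the tensor `([x₁, …, x_l], y₁, y₂, y₃, y₄) ↦ ∇^l_{x₁, …, x_l} R (y₁, y₂, y₃, y₄)`; only lists
of length `l` are meaningful. -/
def nablaRiemann (g : V → V →L[ℝ] V →L[ℝ] ℝ) : ℕ → V → ListTensor V
  | 0 => fun p _ => riemann g p
  | l + 1 => covDeriv g (nablaRiemann g l)

/-- The curve `γ` satisfies the geodesic equation of `g` for all times in `s`. -/
def IsGeodesicOn (g : V → V →L[ℝ] V →L[ℝ] ℝ) (γ : ℝ → V) (s : Set ℝ) : Prop :=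
  ∀ t ∈ s, deriv (deriv γ) t + christoffel g (γ t) (deriv γ t) (deriv γ t) = 0

/-- `g` is given in normal coordinates on `U`: the straight lines from the origin to the points of
`U` are geodesics. -/
def IsNormalOn (g : V → V →L[ℝ] V →L[ℝ] ℝ) (U : Set V) : Prop :=
  ∀ ξ ∈ U, IsGeodesicOn g (fun t : ℝ => t • ξ) (Set.Icc 0 1)

end CurvatureJet

end

open CurvatureJet

/-! The metric is corrected one order at a time, always in normal coordinates. Suppose `g` already
has the prescribed curvature jet at `0` below order `m`, and let `D` be the given jet minus the jet
of `g` at order `m`. Both satisfy the Ricci identities, whose right-hand sides at order `m` involve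
only orders up to `m - 2` and hence agree. So `D` is symmetric in its derivative slots, and it
inherits the linear identities: curvature symmetries and second Bianchi identity
(`IsAlgCurvatureJet.isSymmetricJet_sub`).

Such a `D` is the polarization of a homogeneous polynomial `K_p = D(p, …, p) / m!` with values in
curvature tensors, satisfying the second Bianchi identity of flat space. The Bianchi identities and
Euler's formula show that `h_p(y, z) = -2 / ((m + 2)(m + 3)) K_p(y, p, p, z)` has linearized
curvature exactly `K` (`IsBianchiField.linearizedCurvature_eq`). As `h` vanishes to order `m + 2` at
`0`, passing from `g` to `g + h` changes nothing below order `m` and adds exactly `D` at order `m`;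
the nonlinear and Christoffel corrections vanish to higher order (`IsRegular.flat_jetField_sub`).
Starting from the constant metric `g₀`, `k + 1` such steps suffice
(`IsAlgCurvatureJet.exists_metric`).

Normal coordinates are encoded by the gauge condition `g_p(p, ·) = g₀(p, ·)`. It survives each step
because `h_p(p, ·) = 0` by skew-symmetry, and together with `Dg_0 = 0` it makes the rays from the
origin geodesics (`IsRegular.isNormalOn`).

The jet of a metric must be known to satisfy the same identities at every order. The covariant
derivative in direction `a` is the ordinary derivative at `t = 0` of the tensor at `p + t a`,
evaluated on arguments moved by `id - t Γ(a, ·)` (`IsRegular.hasDerivAt_jetField`). An identity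
valid at all nearby points therefore differentiates to the identity one order higher. For the Ricci
identities one also uses that the metric, pulled back in the same way, has derivative zero. -/

open Filter Topology Set
open scoped ContDiff

noncomputable section

set_option linter.unusedSectionVars false
set_option maxSynthPendingDepth 3

namespace CurvatureJet

/-! ### Calculus of derivations on functions of lists. -/

section

variable {V : Type*} [NormedAddCommGroup V] [NormedSpace ℝ V]

/-! ### Multilinear functions of lists -/

/-- `F` is linear in each entry of the lists of length `n`. -/
def MultiAt : ℕ → (List V → ℝ) → Prop
  | 0, _ => True
  | n + 1, F => (∀ c : List V, c.length = n → IsLinearMap ℝ fun v => F (v :: c)) ∧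
      ∀ b, MultiAt n fun c => F (b :: c)

/-- The derivation of functions of lists induced by an endomorphism. -/
def der (A : V → V) : (List V → ℝ) → List V → ℝ
  | _, [] => 0
  | F, b :: c => -F (A b :: c) + der A (fun Q => F (b :: Q)) c

/-- A list tensor as a function of a single list, the curvature slots being the first four. -/
def flatten (T : ListTensor V) : List V → ℝ
  | y₁ :: y₂ :: y₃ :: y₄ :: c => T c y₁ y₂ y₃ y₄
  | _ => 0

lemma der_tail_eq_act (A : V → V) (T : ListTensor V) (c : List V) (y₁ y₂ y₃ y₄ : V) :
    der A (fun Q => T Q y₁ y₂ y₃ y₄) c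
      - (T c (A y₁) y₂ y₃ y₄ + T c y₁ (A y₂) y₃ y₄ + T c y₁ y₂ (A y₃) y₄ + T c y₁ y₂ y₃ (A y₄))
      = act A T c y₁ y₂ y₃ y₄ := by
  induction c generalizing T with
  | nil => simp [der, act]
  | cons b c ih => rw [der, act, ← ih]; ring

/-- With the curvature slots put at the front of the list, all slots are on the same footing, and
facts about `act` reduce to one-line inductions on `der`. -/
lemma der_flatten (A : V → V) (T : ListTensor V) (c : List V) (y₁ y₂ y₃ y₄ : V) :
    der A (flatten T) (y₁ :: y₂ :: y₃ :: y₄ :: c) = act A T c y₁ y₂ y₃ y₄ := by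
  rw [← der_tail_eq_act]
  simp only [der, flatten]
  ring

lemma der_congr (A : V → V) {F G : List V → ℝ} (L : List V)
    (h : ∀ Q : List V, Q.length = L.length → F Q = G Q) : der A F L = der A G L := by
  induction L generalizing F G with
  | nil => rfl
  | cons b c ih =>
    rw [der, der, h _ (by simp), ih fun Q hQ => h _ (by simp [hQ])]

lemma der_add (A : V → V) (F G : List V → ℝ) (L : List V) :
    der A (fun Q => F Q + G Q) L = der A F L + der A G L := by
  induction L generalizing F G with
  | nil => simp [der]
  | cons b c ih => simp only [der, ih]; ring

lemma der_smul (A : V → V) (r : ℝ) (F : List V → ℝ) (L : List V) :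
    der A (fun Q => r * F Q) L = r * der A F L := by
  induction L generalizing F with
  | nil => simp [der]
  | cons b c ih => simp only [der, ih]; ring

lemma der_neg (A : V → V) (F : List V → ℝ) (L : List V) :
    der A (fun Q => -F Q) L = -der A F L := by
  simpa using der_smul A (-1) F L

lemma MultiAt.congr {n : ℕ} {F G : List V → ℝ} (hF : MultiAt n F)
    (h : ∀ Q : List V, Q.length = n → F Q = G Q) : MultiAt n G := by
  induction n generalizing F G with
  | zero => trivial
  | succ n ih =>
    refine ⟨fun c hc => ?_, fun b => ih (hF.2 b) fun Q hQ => h _ (by simp [hQ])⟩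
    convert hF.1 c hc using 2 with v
    exact (h _ (by simp [hc])).symm

lemma MultiAt.add {n : ℕ} {F G : List V → ℝ} (hF : MultiAt n F) (hG : MultiAt n G) :
    MultiAt n fun Q => F Q + G Q := by
  induction n generalizing F G with
  | zero => trivial
  | succ n ih =>
    refine ⟨fun c hc => ⟨fun x y => ?_, fun r x => ?_⟩, fun b => ih (hF.2 b) (hG.2 b)⟩
    · simp only [(hF.1 c hc).map_add, (hG.1 c hc).map_add]; ring
    · simp only [(hF.1 c hc).map_smul, (hG.1 c hc).map_smul, smul_eq_mul]; ring

lemma MultiAt.const_mul {n : ℕ} {F : List V → ℝ} (s : ℝ) (hF : MultiAt n F) :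
    MultiAt n fun Q => s * F Q := by
  induction n generalizing F with
  | zero => trivial
  | succ n ih =>
    refine ⟨fun c hc => ⟨fun x y => ?_, fun r x => ?_⟩, fun b => ih (hF.2 b)⟩
    · simp only [(hF.1 c hc).map_add]; ring
    · simp only [(hF.1 c hc).map_smul, smul_eq_mul]; ring

lemma MultiAt.neg {n : ℕ} {F : List V → ℝ} (hF : MultiAt n F) : MultiAt n fun Q => -F Q :=
  (hF.const_mul (-1)).congr fun Q _ => by ring

lemma MultiAt.der {n : ℕ} {F : List V → ℝ} (hF : MultiAt n F) {A : V → V} (hA : IsLinearMap ℝ A) :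
    MultiAt n (der A F) := by
  induction n generalizing F with
  | zero => trivial
  | succ n ih =>
    refine ⟨fun c hc => ⟨fun x y => ?_, fun r x => ?_⟩, fun b => ?_⟩
    · simp only [CurvatureJet.der, hA.map_add, (hF.1 c hc).map_add]
      rw [der_congr A c fun Q hQ => (hF.1 Q (hQ.trans hc)).map_add x y, der_add]
      ring
    · simp only [CurvatureJet.der, hA.map_smul, (hF.1 c hc).map_smul, smul_eq_mul]
      rw [der_congr A c fun Q hQ => (hF.1 Q (hQ.trans hc)).map_smul r x]
      simp only [smul_eq_mul, der_smul]
      ring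
    · exact ((hF.2 (A b)).neg).add (ih (hF.2 b))

/-- Terms in which `A` and `B` hit different slots cancel in the commutator. On a single slot, `F (B
(A b)) - F (A (B b))` is minus `F` of the commutator, which is the sign convention of `der`. -/
lemma der_comm {F : List V → ℝ} {A B : V → V} (L : List V) (hF : MultiAt L.length F) :
    der A (der B F) L - der B (der A F) L = der (fun v => A (B v) - B (A v)) F L := by
  induction L generalizing F with
  | nil => simp [der]
  | cons b c ih =>
    have h : ∀ (A B : V → V), der A (der B F) (b :: c) = F (B (A b) :: c)
        - der B (fun Q => F (A b :: Q)) c - der A (fun Q => F (B b :: Q)) c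
        + der A (der B fun Q => F (b :: Q)) c := by
      intro A B
      simp only [der, der_add, der_neg]
      ring
    rw [h, h, der, ← ih (hF.2 b), (hF.1 c rfl).map_sub]
    ring

lemma der_add_endo {F : List V → ℝ} (A B : V → V) (L : List V) (hF : MultiAt L.length F) :
    der (fun v => A v + B v) F L = der A F L + der B F L := by
  induction L generalizing F with
  | nil => simp [der]
  | cons b c ih => simp only [der, (hF.1 c rfl).map_add, ih (hF.2 b)]; ring

lemma der_neg_endo {F : List V → ℝ} (A : V → V) (L : List V) (hF : MultiAt L.length F) :
    der (fun v => -A v) F L = -der A F L := by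
  induction L generalizing F with
  | nil => simp [der]
  | cons b c ih => simp only [der, (hF.1 c rfl).map_neg, ih (hF.2 b)]; ring

/-- The default value `0` of `flatten` on lists too short to fill the curvature slots makes
multilinearity available for every length. -/
lemma multiAt_flatten_of_lt (T : ListTensor V) {n : ℕ} (hn : n < 4) : MultiAt n (flatten T) := by
  have h0 : ∀ n, MultiAt n fun _ : List V => (0 : ℝ) := by
    intro n
    induction n with
    | zero => trivial
    | succ n ih => exact ⟨fun c hc => ⟨by simp, by simp⟩, fun b => ih⟩
  refine (h0 n).congr fun Q hQ => ?_
  match Q, hQ with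
  | [], _ => rfl
  | [_], _ => rfl
  | [_, _], _ => rfl
  | [_, _, _], _ => rfl
  | _ :: _ :: _ :: _ :: _, hQ => simp at hQ; omega

/-! ### Naturality and congruence of the Leibniz expansion -/

lemma act_map {φ : V → V} {A A' : V → V} (h : ∀ u, A (φ u) = φ (A' u)) (T : ListTensor V)
    (c : List V) (y₁ y₂ y₃ y₄ : V) :
    act A T (c.map φ) (φ y₁) (φ y₂) (φ y₃) (φ y₄)
      = act A' (fun Q z₁ z₂ z₃ z₄ => T (Q.map φ) (φ z₁) (φ z₂) (φ z₃) (φ z₄)) c y₁ y₂ y₃ y₄ := by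
  induction c generalizing T with
  | nil => simp [act, h]
  | cons b c ih => simp only [List.map_cons, act, h, ih]

/-- Naturality under a map `φ` intertwining `A` and `A'`; needed with `φ` an infinitesimal parallel
transport. -/
lemma leibniz_map {φ : V → V} {A A' : List V → V → V}
    (h : ∀ P u, A (P.map φ) (φ u) = φ (A' P u)) (T : ListTensor V)
    (a c : List V) (y₁ y₂ y₃ y₄ : V) :
    leibniz A T (a.map φ) (c.map φ) (φ y₁) (φ y₂) (φ y₃) (φ y₄)
      = leibniz A' (fun Q z₁ z₂ z₃ z₄ => T (Q.map φ) (φ z₁) (φ z₂) (φ z₃) (φ z₄)) a c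
          y₁ y₂ y₃ y₄ := by
  induction a generalizing A A' T with
  | nil => exact act_map (h []) T c y₁ y₂ y₃ y₄
  | cons b a ih =>
    simp only [List.map_cons, leibniz]
    rw [ih (A' := fun P => A' (b :: P)) fun P u => h (b :: P) u, ih h]

lemma act_congr {A A' : V → V} {T T' : ListTensor V} (hA : A = A') (c : List V)
    (hT : ∀ Q : List V, Q.length = c.length → T Q = T' Q) :
    act A T c = act A' T' c := by
  subst hA
  funext y₁ y₂ y₃ y₄
  induction c generalizing T T' with
  | nil => simp [act, hT]
  | cons b c ih =>
    rw [act, act, hT (A b :: c) (by simp), ih fun Q hQ => hT (b :: Q) (by simp [hQ])]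

/-- The length bounds are the point: the right-hand side of a Ricci identity of order `|a| + |c| +
2` only sees derivatives of order at most `|a| + |c|`. -/
lemma leibniz_congr {A A' : List V → V → V} {T T' : ListTensor V} (a c : List V)
    (hA : ∀ P : List V, P.length ≤ a.length → A P = A' P)
    (hT : ∀ Q : List V, Q.length ≤ a.length + c.length → T Q = T' Q) :
    leibniz A T a c = leibniz A' T' a c := by
  funext y₁ y₂ y₃ y₄
  induction a generalizing A A' T T' with
  | nil =>
    exact congrFun (congrFun (congrFun (congrFun
      (act_congr (hA [] (by simp)) c fun Q hQ => hT Q (by simp [hQ])) y₁) y₂) y₃) y₄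
  | cons b a ih =>
    rw [leibniz, leibniz]
    congr 1
    · exact ih (fun P hP => hA _ (by simpa using hP))
        fun Q hQ => hT Q (hQ.trans (by simp only [List.length_cons]; omega))
    · exact ih (fun P hP => hA _ (hP.trans (by simp)))
        fun Q hQ => hT _ (by simp only [List.length_cons]; omega)

/-! ### Derivatives of multilinear expressions -/

section Derivatives

variable [FiniteDimensional ℝ V]

lemma IsLinearMap.eq_sum_coord {f : V → ℝ} (hf : IsLinearMap ℝ f) (v : V) :
    f v = ∑ i, (LinearMap.toContinuousLinearMap ((Module.finBasis ℝ V).coord i)) v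
      * f (Module.finBasis ℝ V i) := by
  conv_lhs => rw [← (Module.finBasis ℝ V).sum_repr v]
  rw [← hf.mk'_apply, map_sum]
  simp

/-- Product rule for a linear form known only through its values. Expanding the argument in a basis
reduces it to a finite sum of products of real functions. -/
lemma hasDerivAt_slot {L : ℝ → V → ℝ} {L' : V → ℝ} {w : ℝ → V} {w' : V}
    (hlin : ∀ᶠ t in 𝓝 0, IsLinearMap ℝ (L t)) (hL : ∀ v, HasDerivAt (fun t => L t v) (L' v) 0)
    (hw : HasDerivAt w w' 0) :
    HasDerivAt (fun t => L t (w t)) (L' (w 0) + L 0 w') 0 := by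
  -- Linearity passes to the derivative by uniqueness of derivatives.
  have hL' : IsLinearMap ℝ L' := by
    constructor
    · intro x y
      refine (hL _).unique (((hL x).add (hL y)).congr_of_eventuallyEq ?_)
      filter_upwards [hlin] with t ht using ht.map_add x y
    · intro r x
      refine (hL _).unique (((hL x).const_mul r).congr_of_eventuallyEq ?_)
      filter_upwards [hlin] with t ht using ht.map_smul r x
  have key : HasDerivAt (fun t => ∑ i,
      (LinearMap.toContinuousLinearMap ((Module.finBasis ℝ V).coord i)) (w t)
        * L t (Module.finBasis ℝ V i)) (L' (w 0) + L 0 w') 0 := by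
    rw [IsLinearMap.eq_sum_coord hL' (w 0), IsLinearMap.eq_sum_coord hlin.self_of_nhds w',
      ← Finset.sum_add_distrib]
    refine HasDerivAt.fun_sum fun i _ => ?_
    refine (((LinearMap.toContinuousLinearMap ((Module.finBasis ℝ V).coord i)).hasFDerivAt
      |>.comp_hasDerivAt 0 hw).fun_mul (hL (Module.finBasis ℝ V i))).congr_deriv ?_
    simp only [Function.comp]
    ring
  refine key.congr_of_eventuallyEq ?_
  filter_upwards [hlin] with t ht using IsLinearMap.eq_sum_coord ht (w t)

lemma hasDerivAt_der {A : ℝ → V → V} {A' : V → V} {F : ℝ → List V → ℝ} {F' : List V → ℝ}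
    (L : List V) (hm : ∀ᶠ t in 𝓝 0, MultiAt L.length (F t))
    (hF : ∀ Q : List V, Q.length = L.length → HasDerivAt (fun t => F t Q) (F' Q) 0)
    (hA : ∀ v, HasDerivAt (fun t => A t v) (A' v) 0) :
    HasDerivAt (fun t => der (A t) (F t) L) (der A' (F 0) L + der (A 0) F' L) 0 := by
  induction L generalizing F F' with
  | nil => simpa [der] using hasDerivAt_const (0 : ℝ) (0 : ℝ)
  | cons b c ih =>
    have h1 := hasDerivAt_slot (L := fun t v => F t (v :: c)) (hm.mono fun t ht => ht.1 c rfl)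
      (fun v => hF (v :: c) (by simp)) (hA b)
    have h2 := ih (F := fun t Q => F t (b :: Q)) (hm.mono fun t ht => ht.2 b)
      (fun Q hQ => hF (b :: Q) (by simp [hQ]))
    refine (h1.fun_neg.fun_add h2).congr_deriv ?_
    simp only [der]
    ring

/-- Each slot contributes `-F(…, A b, …)` by the product rule, and these add up to `der A F`. For `A
= Γ(a, ·)` the result is the formula for the covariant derivative. -/
lemma hasDerivAt_list_map {φ : ℝ → V → V} {A : V → V} {F : ℝ → List V → ℝ} {F' : List V → ℝ}
    (L : List V) (hm : ∀ᶠ t in 𝓝 0, MultiAt L.length (F t))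
    (hF : ∀ Q : List V, Q.length = L.length → HasDerivAt (fun t => F t Q) (F' Q) 0)
    (hφ : ∀ v, HasDerivAt (fun t => φ t v) (-A v) 0) (hφ0 : ∀ v, φ 0 v = v) :
    HasDerivAt (fun t => F t (L.map (φ t))) (F' L + der A (F 0) L) 0 := by
  induction L generalizing F F' with
  | nil => simpa [der] using hF [] rfl
  | cons b c ih =>
    have h1 : ∀ Q : List V, Q.length = c.length → HasDerivAt (fun t => F t (φ t b :: Q))
        (F' (b :: Q) - F 0 (A b :: Q)) 0 := by
      intro Q hQ
      refine (hasDerivAt_slot (L := fun t v => F t (v :: Q)) (hm.mono fun t ht => ht.1 Q hQ)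
        (fun v => hF (v :: Q) (by simp [hQ])) (hφ b)).congr_deriv ?_
      rw [hφ0, (hm.self_of_nhds.1 Q hQ).map_neg]
      ring
    have h2 := ih (F := fun t Q => F t (φ t b :: Q)) (hm.mono fun t ht => ht.2 _) h1
    refine h2.congr_deriv ?_
    simp only [der, hφ0]
    ring

lemma contDiffOn_slot {U : Set V} {L : V → V → ℝ} {w : V → V}
    (hlin : ∀ p ∈ U, IsLinearMap ℝ (L p)) (hL : ∀ v, ContDiffOn ℝ ∞ (fun p => L p v) U)
    (hw : ContDiffOn ℝ ∞ w U) : ContDiffOn ℝ ∞ (fun p => L p (w p)) U := by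
  refine ContDiffOn.congr (f := fun p => ∑ i,
      (LinearMap.toContinuousLinearMap ((Module.finBasis ℝ V).coord i)) (w p)
        * L p (Module.finBasis ℝ V i)) ?_ fun p hp => IsLinearMap.eq_sum_coord (hlin p hp) (w p)
  exact ContDiffOn.sum fun i _ =>
    ((ContinuousLinearMap.contDiff _).comp_contDiffOn hw).mul (hL _)

lemma contDiffOn_der {U : Set V} {A : V → V → V} {F : V → List V → ℝ} (L : List V)
    (hm : ∀ p ∈ U, MultiAt L.length (F p))
    (hF : ∀ Q : List V, Q.length = L.length → ContDiffOn ℝ ∞ (fun p => F p Q) U)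
    (hA : ∀ v, ContDiffOn ℝ ∞ (fun p => A p v) U) :
    ContDiffOn ℝ ∞ (fun p => der (A p) (F p) L) U := by
  induction L generalizing F with
  | nil => simpa [der] using contDiffOn_const
  | cons b c ih =>
    exact (contDiffOn_slot (L := fun p v => F p (v :: c)) (fun p hp => (hm p hp).1 c rfl)
      (fun v => hF (v :: c) (by simp)) (hA b)).neg.add
      (ih (F := fun p Q => F p (b :: Q)) (fun p hp => (hm p hp).2 b)
      (fun Q hQ => hF (b :: Q) (by simp [hQ])))

lemma hasDerivAt_act {A : ℝ → V → V} {A' : V → V} {T : ℝ → ListTensor V} {T' : ListTensor V}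
    (c : List V) (y₁ y₂ y₃ y₄ : V) (hm : ∀ᶠ t in 𝓝 0, ∀ n, MultiAt n (flatten (T t)))
    (hT : ∀ Q z₁ z₂ z₃ z₄, HasDerivAt (fun t => T t Q z₁ z₂ z₃ z₄) (T' Q z₁ z₂ z₃ z₄) 0)
    (hA : ∀ v, HasDerivAt (fun t => A t v) (A' v) 0) :
    HasDerivAt (fun t => act (A t) (T t) c y₁ y₂ y₃ y₄)
      (act A' (T 0) c y₁ y₂ y₃ y₄ + act (A 0) T' c y₁ y₂ y₃ y₄) 0 := by
  simp only [← der_flatten]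
  refine hasDerivAt_der _ (hm.mono fun t ht => ht _) (fun Q hQ => ?_) hA
  match Q, hQ with
  | z₁ :: z₂ :: z₃ :: z₄ :: Q, _ => exact hT Q z₁ z₂ z₃ z₄

lemma hasDerivAt_leibniz {A : ℝ → List V → V → V} {A' : List V → V → V} {T : ℝ → ListTensor V}
    {T' : ListTensor V} (a c : List V) (y₁ y₂ y₃ y₄ : V)
    (hm : ∀ᶠ t in 𝓝 0, ∀ P n, MultiAt n (flatten fun Q => T t (P ++ Q)))
    (hT : ∀ Q z₁ z₂ z₃ z₄, HasDerivAt (fun t => T t Q z₁ z₂ z₃ z₄) (T' Q z₁ z₂ z₃ z₄) 0)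
    (hA : ∀ P v, HasDerivAt (fun t => A t P v) (A' P v) 0) :
    HasDerivAt (fun t => leibniz (A t) (T t) a c y₁ y₂ y₃ y₄)
      (leibniz A' (T 0) a c y₁ y₂ y₃ y₄ + leibniz (A 0) T' a c y₁ y₂ y₃ y₄) 0 := by
  induction a generalizing A A' T T' with
  | nil => exact hasDerivAt_act c y₁ y₂ y₃ y₄ (hm.mono fun t ht => ht []) hT (hA [])
  | cons b a ih =>
    have h1 := ih (A := fun t P => A t (b :: P)) hm hT (fun P v => hA _ _)
    have h2 := ih (T := fun t Q => T t (b :: Q)) (hm.mono fun t ht P => ht (b :: P))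
      (fun Q => hT (b :: Q)) hA
    refine (h1.fun_add h2).congr_deriv ?_
    simp only [leibniz]
    ring

end Derivatives

end

/-! ### The Levi-Civita connection, the curvature tensor and its classical identities. -/

section

variable {V : Type*} [NormedAddCommGroup V] [NormedSpace ℝ V] [FiniteDimensional ℝ V]

/-! ### Christoffel symbols and the curvature tensor -/

lemma two_le_infty : (2 : WithTop ℕ∞) ≤ ∞ := WithTop.coe_le_coe.2 le_top

/-- A smooth field of symmetric bilinear forms which is nondegenerate on the open set `U`. -/
structure IsRegular (g : V → V →L[ℝ] V →L[ℝ] ℝ) (U : Set V) : Prop where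
  isOpen : IsOpen U
  smooth : ContDiff ℝ ∞ g
  symm : ∀ p x y, g p x y = g p y x
  inv : ∀ p ∈ U, (g p).IsInvertible

lemma IsScalarProduct.isInvertible {b : V →L[ℝ] V →L[ℝ] ℝ} (hb : IsScalarProduct b) :
    b.IsInvertible := by
  have hinj : Function.Injective (b : V →ₗ[ℝ] V →L[ℝ] ℝ) := by
    rw [← LinearMap.ker_eq_bot, LinearMap.ker_eq_bot']
    intro x hx
    exact hb.nondegenerate x fun y => by
      have := congrArg (fun f : V →L[ℝ] ℝ => f y) hx
      simpa using this
  have hdim : Module.finrank ℝ V = Module.finrank ℝ (V →L[ℝ] ℝ) := by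
    rw [← (LinearMap.toContinuousLinearMap (𝕜 := ℝ) (E := V) (F' := ℝ)).finrank_eq]
    exact (Subspace.dual_finrank_eq (K := ℝ) (V := V)).symm
  exact ⟨(LinearEquiv.ofInjectiveOfFinrankEq _ hinj hdim).toContinuousLinearEquiv, by ext; rfl⟩

lemma isScalarProduct_of_isInvertible {b : V →L[ℝ] V →L[ℝ] ℝ} (hs : ∀ x y, b x y = b y x)
    (hb : b.IsInvertible) : IsScalarProduct b :=
  ⟨hs, fun x hx => hb.injective (by ext y; simpa using hx y)⟩

lemma eventually_isInvertible {b : V →L[ℝ] V →L[ℝ] ℝ} (hb : b.IsInvertible) :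
    ∀ᶠ c in 𝓝 b, c.IsInvertible := by
  obtain ⟨e, rfl⟩ := hb
  filter_upwards [ContinuousLinearEquiv.nhds e] with c hc using hc

/-- The Christoffel symbols as a bilinear map. -/
def christoffelL (g : V → V →L[ℝ] V →L[ℝ] ℝ) (p : V) : V →L[ℝ] V →L[ℝ] V :=
  LinearMap.toContinuousLinearMap (LinearMap.toContinuousLinearMap.toLinearMap ∘ₗ
    LinearMap.mk₂ ℝ (christoffel g p)
      (fun x y z => by
        simp only [christoffel, ← map_add, ← smul_add]
        congr 2; ext w; simp; ring)
      (fun r x y => by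
        simp only [christoffel, ← map_smul]
        congr 1; ext w; simp; ring)
      (fun x y z => by
        simp only [christoffel, ← map_add, ← smul_add]
        congr 2; ext w; simp; ring)
      (fun r x y => by
        simp only [christoffel, ← map_smul]
        congr 1; ext w; simp; ring))

@[simp] lemma christoffelL_apply (g : V → V →L[ℝ] V →L[ℝ] ℝ) (p u v : V) :
    christoffelL g p u v = christoffel g p u v := rfl

lemma isLinearMap_christoffel (g : V → V →L[ℝ] V →L[ℝ] ℝ) (p u : V) :
    IsLinearMap ℝ (christoffel g p u) :=
  (christoffelL g p u).toLinearMap.isLinear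

lemma christoffel_add_left (g : V → V →L[ℝ] V →L[ℝ] ℝ) (p u u' v : V) :
    christoffel g p (u + u') v = christoffel g p u v + christoffel g p u' v := by
  simp [← christoffelL_apply]

lemma christoffel_smul_left (g : V → V →L[ℝ] V →L[ℝ] ℝ) (p : V) (r : ℝ) (u v : V) :
    christoffel g p (r • u) v = r • christoffel g p u v := by
  simp [← christoffelL_apply]

lemma christoffel_add_right (g : V → V →L[ℝ] V →L[ℝ] ℝ) (p u v v' : V) :
    christoffel g p u (v + v') = christoffel g p u v + christoffel g p u v' :=
  (isLinearMap_christoffel g p u).map_add v v'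

lemma christoffel_sub_right (g : V → V →L[ℝ] V →L[ℝ] ℝ) (p u v v' : V) :
    christoffel g p u (v - v') = christoffel g p u v - christoffel g p u v' :=
  (isLinearMap_christoffel g p u).map_sub v v'

namespace IsRegular

variable {g : V → V →L[ℝ] V →L[ℝ] ℝ} {U : Set V} {p : V}

lemma differentiableAt (hg : IsRegular g U) (p : V) : DifferentiableAt ℝ g p :=
  hg.smooth.differentiable (by simp) p

lemma smooth_fderiv (hg : IsRegular g U) : ContDiff ℝ ∞ (fderiv ℝ g) :=
  hg.smooth.fderiv_right (by simp)

lemma fderiv_symm (hg : IsRegular g U) (p w x y : V) :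
    fderiv ℝ g p w x y = fderiv ℝ g p w y x := by
  have h : ∀ x y, HasFDerivAt (fun q => g q x y)
      (((ContinuousLinearMap.apply ℝ ℝ y) ∘L (ContinuousLinearMap.apply ℝ (V →L[ℝ] ℝ) x))
        ∘L fderiv ℝ g p) p := fun x y =>
    ((ContinuousLinearMap.apply ℝ ℝ y) ∘L
      (ContinuousLinearMap.apply ℝ (V →L[ℝ] ℝ) x)).hasFDerivAt.comp p
        (hg.differentiableAt p).hasFDerivAt
  have h2 := h y x
  simp only [fun q => hg.symm q y x] at h2
  exact congrArg (fun f : V →L[ℝ] ℝ => f w) ((h x y).unique h2)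

lemma apply_christoffel (hg : IsRegular g U) (hp : p ∈ U) (u v w : V) :
    g p (christoffel g p u v) w
      = (fderiv ℝ g p u v w + fderiv ℝ g p v u w - fderiv ℝ g p w u v) / 2 := by
  rw [christoffel, (hg.inv p hp).self_apply_inverse]
  simp
  ring

lemma christoffel_comm (hg : IsRegular g U) (p u v : V) :
    christoffel g p u v = christoffel g p v u := by
  rw [christoffel, christoffel]
  congr 2
  ext w
  simp [hg.fderiv_symm p w u v]
  ring

/-- Metric compatibility `∇g = 0`: two Koszul formulas are added and the extra terms cancel. -/
lemma fderiv_eq (hg : IsRegular g U) (hp : p ∈ U) (x u w : V) :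
    fderiv ℝ g p x u w = g p (christoffel g p x u) w + g p u (christoffel g p x w) := by
  rw [hg.symm p u, hg.apply_christoffel hp, hg.apply_christoffel hp, hg.fderiv_symm p x w u,
    hg.fderiv_symm p u x w, hg.fderiv_symm p w x u]
  ring

lemma ext (hg : IsRegular g U) (hp : p ∈ U) {x y : V} (h : ∀ w, g p x w = g p y w) : x = y :=
  (hg.inv p hp).injective (by ext w; exact h w)

lemma contDiffOn_inverse (hg : IsRegular g U) : ContDiffOn ℝ ∞ (fun p => (g p).inverse) U :=
  fun p hp => ((hg.inv p hp).contDiffAt_map_inverse.comp p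
    hg.smooth.contDiffAt).contDiffWithinAt

lemma contDiffOn_christoffel (hg : IsRegular g U) (u v : V) :
    ContDiffOn ℝ ∞ (fun p => christoffel g p u v) U := by
  have hd : ContDiff ℝ ∞ (fderiv ℝ g) := hg.smooth_fderiv
  refine hg.contDiffOn_inverse.clm_apply (ContDiff.contDiffOn ?_)
  refine ContDiff.const_smul (1 / 2 : ℝ) (ContDiff.sub (ContDiff.add ?_ ?_) ?_)
  · exact (hd.clm_apply contDiff_const).clm_apply contDiff_const
  · exact (hd.clm_apply contDiff_const).clm_apply contDiff_const
  · refine contDiff_clm_apply_iff.2 fun w => ?_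
    simp only [ContinuousLinearMap.flip_apply]
    exact ((hd.clm_apply contDiff_const).clm_apply contDiff_const).clm_apply contDiff_const

lemma contDiffOn_christoffelL (hg : IsRegular g U) : ContDiffOn ℝ ∞ (christoffelL g) U :=
  contDiffOn_clm_apply.2 fun u => contDiffOn_clm_apply.2 fun v => hg.contDiffOn_christoffel u v

lemma hasFDerivAt_christoffelL (hg : IsRegular g U) (hp : p ∈ U) :
    HasFDerivAt (christoffelL g) (fderiv ℝ (christoffelL g) p) p :=
  ((hg.contDiffOn_christoffelL.contDiffAt (hg.isOpen.mem_nhds hp)).differentiableAt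
    (by simp)).hasFDerivAt

lemma hasFDerivAt_fderiv_christoffelL (hg : IsRegular g U) (hp : p ∈ U) :
    HasFDerivAt (fderiv ℝ (christoffelL g)) (fderiv ℝ (fderiv ℝ (christoffelL g)) p) p :=
  (((hg.contDiffOn_christoffelL.contDiffAt (hg.isOpen.mem_nhds hp)).fderiv_right
    (m := ∞) (by simp)).differentiableAt (by simp)).hasFDerivAt

lemma fderiv_christoffel (hg : IsRegular g U) (hp : p ∈ U) (x u v : V) :
    fderiv ℝ (fun q => christoffel g q u v) p x = fderiv ℝ (christoffelL g) p x u v := by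
  have h := ((hg.hasFDerivAt_christoffelL hp).clm_apply (hasFDerivAt_const u p)).clm_apply
    (hasFDerivAt_const v p)
  simp only [christoffelL_apply] at h
  rw [h.fderiv]
  simp

end IsRegular

/-- The curvature operator `R(u, v) w`. -/
def curvatureOp (g : V → V →L[ℝ] V →L[ℝ] ℝ) (p u v w : V) : V :=
  fderiv ℝ (christoffelL g) p u v w - fderiv ℝ (christoffelL g) p v u w
    + christoffelL g p u (christoffelL g p v w) - christoffelL g p v (christoffelL g p u w)

/-- The curvature tensor of the linearized metric with second derivative `D`. -/
def linearCurvature (D : V → V → V → V → ℝ) (u v w z : V) : ℝ :=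
  (D u w v z - D u z v w - D v w u z + D v z u w) / 2

namespace IsRegular

variable {g : V → V →L[ℝ] V →L[ℝ] ℝ} {U : Set V} {p : V}

lemma riemann_eq (hg : IsRegular g U) (hp : p ∈ U) (u v w z : V) :
    riemann g p u v w z = g p (curvatureOp g p u v w) z := by
  rw [riemann, hg.fderiv_christoffel hp, hg.fderiv_christoffel hp]
  rfl

lemma hasFDerivAt_fderiv (hg : IsRegular g U) (p : V) :
    HasFDerivAt (fderiv ℝ g) (fderiv ℝ (fderiv ℝ g) p) p :=
  (hg.smooth_fderiv.differentiable (by simp) p).hasFDerivAt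

lemma fderiv_fderiv_apply (hg : IsRegular g U) (p x u v w : V) :
    fderiv ℝ (fun q => fderiv ℝ g q u v w) p x = fderiv ℝ (fderiv ℝ g) p x u v w := by
  rw [((((hg.hasFDerivAt_fderiv p).clm_apply (hasFDerivAt_const u p)).clm_apply
    (hasFDerivAt_const v p)).clm_apply (hasFDerivAt_const w p)).fderiv]
  simp

lemma fderiv_fderiv_comm (hg : IsRegular g U) (p x u v w : V) :
    fderiv ℝ (fderiv ℝ g) p x u v w = fderiv ℝ (fderiv ℝ g) p u x v w := by
  rw [(hg.smooth.contDiffAt.isSymmSndFDerivAt (by simpa using two_le_infty)).eq x u]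

lemma fderiv_fderiv_symm (hg : IsRegular g U) (p x u v w : V) :
    fderiv ℝ (fderiv ℝ g) p x u v w = fderiv ℝ (fderiv ℝ g) p x u w v := by
  rw [← hg.fderiv_fderiv_apply, ← hg.fderiv_fderiv_apply]
  simp only [hg.fderiv_symm _ u v w]

/-- Koszul's formula is differentiated in its lowered form, so that the inverse of the metric never
has to be differentiated explicitly. -/
lemma apply_fderiv_christoffelL (hg : IsRegular g U) (hp : p ∈ U) (x u v w : V) :
    fderiv ℝ g p x (christoffel g p u v) w + g p (fderiv ℝ (christoffelL g) p x u v) w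
      = (fderiv ℝ (fderiv ℝ g) p x u v w + fderiv ℝ (fderiv ℝ g) p x v u w
        - fderiv ℝ (fderiv ℝ g) p x w u v) / 2 := by
  have h1 := ((hg.differentiableAt p).hasFDerivAt.clm_apply
    (((hg.hasFDerivAt_christoffelL hp).clm_apply (hasFDerivAt_const u p)).clm_apply
    (hasFDerivAt_const v p))).clm_apply (hasFDerivAt_const w p)
  have h2 : ∀ a b c, HasFDerivAt (fun q => fderiv ℝ g q a b c) _ p := fun a b c =>
    ((((hg.hasFDerivAt_fderiv p).clm_apply (hasFDerivAt_const a p)).clm_apply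
    (hasFDerivAt_const b p)).clm_apply (hasFDerivAt_const c p))
  have h3 := (((h2 u v w).add (h2 v u w)).sub (h2 w u v)).const_mul (1 / 2)
  have h4 := h1.unique (h3.congr_of_eventuallyEq (by
    filter_upwards [hg.isOpen.mem_nhds hp] with q hq
    rw [christoffelL_apply, hg.apply_christoffel hq]
    simp
    ring))
  have h5 := congrArg (fun f : V →L[ℝ] ℝ => f x) h4
  simp at h5
  linarith

/-- Metric compatibility turns the derivative of the metric into terms quadratic in `Γ`. What
remains is linear in the second derivatives; this splitting serves both the curvature symmetries and
the perturbation argument. -/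
lemma riemann_eq_linearCurvature (hg : IsRegular g U) (hp : p ∈ U) (u v w z : V) :
    riemann g p u v w z
      = linearCurvature (fun a b c d => fderiv ℝ (fderiv ℝ g) p a b c d) u v w z
        - g p (christoffel g p v w) (christoffel g p u z)
        + g p (christoffel g p u w) (christoffel g p v z) := by
  have h1 := hg.apply_fderiv_christoffelL hp u v w z
  have h2 := hg.apply_fderiv_christoffelL hp v u w z
  rw [hg.fderiv_eq hp] at h1 h2
  rw [hg.riemann_eq hp, curvatureOp, linearCurvature]
  simp only [map_add, map_sub, add_apply, sub_apply,
    christoffelL_apply]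
  -- The second derivatives along `u` and `v` of the entry `(w, z)` cancel under antisymmetrization.
  rw [hg.fderiv_fderiv_comm p v u w z] at h2
  linarith

lemma isAlgCurvature_riemann (hg : IsRegular g U) (hp : p ∈ U) :
    IsAlgCurvature (riemann g p) := by
  have hs := hg.fderiv_fderiv_symm p
  have hc := hg.fderiv_fderiv_comm p
  have h := hg.christoffel_comm p
  constructor
  · intro u v w z
    simp only [riemann]
    rw [← neg_inj, neg_neg, ← neg_apply, ← map_neg]
    congr 2
    abel
  · intro u v w z
    rw [hg.riemann_eq_linearCurvature hp, hg.riemann_eq_linearCurvature hp]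
    simp only [linearCurvature]
    rw [hc w u z v, hc w v z u, hc z u w v, hc z v w u, hs u w z v, hs u z w v, hs v w z u,
      hs v z w u, h z u, h w v, h w u, h z v, hg.symm p (christoffel g p u z)]
    ring
  · intro u v w z
    rw [hg.riemann_eq_linearCurvature hp, hg.riemann_eq_linearCurvature hp,
      hg.riemann_eq_linearCurvature hp]
    simp only [linearCurvature]
    rw [hc v u, hc w u, hc w v, hs u v w z, hs u z v w, hs v z u w, hs u w v z, hs v w u z,
      hs w z u v, h v u, h w u, h w v]
    ring

lemma fderiv_riemann (hg : IsRegular g U) (hp : p ∈ U) (x u v w z : V) :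
    fderiv ℝ (fun q => riemann g q u v w z) p x =
      g p (fderiv ℝ (fderiv ℝ (christoffelL g)) p x u v w
        - fderiv ℝ (fderiv ℝ (christoffelL g)) p x v u w
        + (fderiv ℝ (christoffelL g) p x u (christoffel g p v w)
            + christoffel g p u (fderiv ℝ (christoffelL g) p x v w))
        - (fderiv ℝ (christoffelL g) p x v (christoffel g p u w)
            + christoffel g p v (fderiv ℝ (christoffelL g) p x u w))
        + christoffel g p x (curvatureOp g p u v w)) z
      + g p (curvatureOp g p u v w) (christoffel g p x z) := by
  have hG := hg.hasFDerivAt_christoffelL hp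
  have hG2 := hg.hasFDerivAt_fderiv_christoffelL hp
  have c : ∀ y : V, HasFDerivAt (fun _ : V => y) (0 : V →L[ℝ] V) p := fun y => hasFDerivAt_const y p
  have h1 := (((hG2.clm_apply (c u)).clm_apply (c v)).clm_apply (c w)).sub
    (((hG2.clm_apply (c v)).clm_apply (c u)).clm_apply (c w))
  have h2 := (hG.clm_apply (c u)).clm_apply ((hG.clm_apply (c v)).clm_apply (c w))
  have h3 := (hG.clm_apply (c v)).clm_apply ((hG.clm_apply (c u)).clm_apply (c w))
  have h4 := ((hg.differentiableAt p).hasFDerivAt.clm_apply ((h1.add h2).sub h3)).clm_apply (c z)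
  have h5 := h4.congr_of_eventuallyEq (f₁ := fun q => riemann g q u v w z) (by
    filter_upwards [hg.isOpen.mem_nhds hp] with q hq
    rw [hg.riemann_eq hq]
    rfl)
  rw [h5.fderiv]
  simp [hg.fderiv_eq hp, curvatureOp, christoffel_add_right, christoffel_sub_right]
  ring

lemma fderiv_fderiv_christoffelL_comm (hg : IsRegular g U) (hp : p ∈ U) (x u v w : V) :
    fderiv ℝ (fderiv ℝ (christoffelL g)) p x u v w
      = fderiv ℝ (fderiv ℝ (christoffelL g)) p u x v w := by
  rw [((hg.contDiffOn_christoffelL.contDiffAt (hg.isOpen.mem_nhds hp)).isSymmSndFDerivAt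
    (by simpa using two_le_infty)).eq x u]

/-- The covariant derivative of the curvature tensor. -/
lemma nabla_riemann (hg : IsRegular g U) (hp : p ∈ U) (x u v w z : V) :
    fderiv ℝ (fun q => riemann g q u v w z) p x - (riemann g p (christoffel g p x u) v w z
      + riemann g p u (christoffel g p x v) w z + riemann g p u v (christoffel g p x w) z
      + riemann g p u v w (christoffel g p x z)) =
      g p (fderiv ℝ (fderiv ℝ (christoffelL g)) p x u v w
        - fderiv ℝ (fderiv ℝ (christoffelL g)) p x v u w
        + (fderiv ℝ (christoffelL g) p x u (christoffel g p v w)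
            + christoffel g p u (fderiv ℝ (christoffelL g) p x v w))
        - (fderiv ℝ (christoffelL g) p x v (christoffel g p u w)
            + christoffel g p v (fderiv ℝ (christoffelL g) p x u w))
        + christoffel g p x (curvatureOp g p u v w)
        - curvatureOp g p (christoffel g p x u) v w - curvatureOp g p u (christoffel g p x v) w
        - curvatureOp g p u v (christoffel g p x w)) z := by
  rw [hg.fderiv_riemann hp, hg.riemann_eq hp, hg.riemann_eq hp, hg.riemann_eq hp,
    hg.riemann_eq hp]
  simp only [map_add, map_sub, add_apply, sub_apply]
  ring

/-- With the last index raised, this is a cancellation in `V`: second derivatives of `Γ` cancel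
because they commute, and the terms with `Γ(x, u)` in a curvature slot cancel because the connection
is torsion free. -/
lemma bianchi_riemann (hg : IsRegular g U) (hp : p ∈ U) (x u v w z : V) (N : V → V → V → ℝ)
    (hN : ∀ x u v, N x u v = fderiv ℝ (fun q => riemann g q u v w z) p x
      - (riemann g p (christoffel g p x u) v w z
      + riemann g p u (christoffel g p x v) w z + riemann g p u v (christoffel g p x w) z
      + riemann g p u v w (christoffel g p x z))) :
    N x u v + N u v x + N v x u = 0 := by
  rw [hN, hN, hN, hg.nabla_riemann hp, hg.nabla_riemann hp, hg.nabla_riemann hp,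
    ← add_apply, ← map_add, ← add_apply, ← map_add]
  have hc := hg.fderiv_fderiv_christoffelL_comm hp
  have h := hg.christoffel_comm p
  refine (congrArg (fun y => g p y z) (?_ : _ = (0 : V))).trans (by simp)
  rw [hc u x, hc v x, hc v u]
  simp only [curvatureOp, ← christoffelL_apply, map_add, map_sub]
  simp only [christoffelL_apply, h u x, h v u, h v x]
  abel

end IsRegular

end

/-! ### Iterated covariant derivatives, differentiated by infinitesimal parallel transport. -/

section

variable {V : Type*} [NormedAddCommGroup V] [NormedSpace ℝ V] [FiniteDimensional ℝ V]

/-! ### The field of all iterated covariant derivatives -/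

/-- All iterated covariant derivatives of the curvature tensor as a single list tensor. -/
def jetField (g : V → V →L[ℝ] V →L[ℝ] ℝ) (p : V) : ListTensor V :=
  fun a => nablaRiemann g a.length p a

lemma jetField_cons (g : V → V →L[ℝ] V →L[ℝ] ℝ) (p a : V) (c : List V) (y₁ y₂ y₃ y₄ : V) :
    jetField g p (a :: c) y₁ y₂ y₃ y₄ = fderiv ℝ (fun q => jetField g q c y₁ y₂ y₃ y₄) p a
      + act (christoffel g p a) (jetField g p) c y₁ y₂ y₃ y₄ := by
  rw [jetField, List.length_cons, nablaRiemann, covDeriv,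
    act_congr (T' := jetField g p) rfl c fun Q hQ => by rw [jetField, hQ]]
  rfl

/-- The covariant derivative of a field of functions of lists. -/
def cov (g : V → V →L[ℝ] V →L[ℝ] ℝ) (F : V → List V → ℝ) (p a : V) (L : List V) : ℝ :=
  fderiv ℝ (fun q => F q L) p a + der (christoffel g p a) (F p) L

lemma flatten_jetField_cons (g : V → V →L[ℝ] V →L[ℝ] ℝ) (p a : V) (c : List V)
    (y₁ y₂ y₃ y₄ : V) :
    flatten (jetField g p) (y₁ :: y₂ :: y₃ :: y₄ :: a :: c)
      = cov g (fun q => flatten (jetField g q)) p a (y₁ :: y₂ :: y₃ :: y₄ :: c) := by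
  rw [cov, der_flatten]
  exact jetField_cons g p a c y₁ y₂ y₃ y₄

lemma multiAt_fderiv {U : Set V} (hU : IsOpen U) {F : V → List V → ℝ} {p : V} (hp : p ∈ U)
    (a : V) {n : ℕ} (hm : ∀ q ∈ U, MultiAt n (F q))
    (hd : ∀ L : List V, L.length = n → DifferentiableAt ℝ (fun q => F q L) p) :
    MultiAt n fun L => fderiv ℝ (fun q => F q L) p a := by
  induction n generalizing F with
  | zero => trivial
  | succ n ih =>
    refine ⟨fun c hc => ⟨fun x y => ?_, fun r x => ?_⟩, fun b =>
      ih (fun q hq => (hm q hq).2 b) fun L hL => hd _ (by simp [hL])⟩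
    · have h : (fun q => F q ((x + y) :: c)) =ᶠ[𝓝 p] fun q => F q (x :: c) + F q (y :: c) := by
        filter_upwards [hU.mem_nhds hp] with q hq using ((hm q hq).1 c hc).map_add x y
      beta_reduce
      rw [h.fderiv_eq, fderiv_fun_add (hd _ (by simp [hc])) (hd _ (by simp [hc]))]
      rfl
    · have h : (fun q => F q ((r • x) :: c)) =ᶠ[𝓝 p] fun q => r * F q (x :: c) := by
        filter_upwards [hU.mem_nhds hp] with q hq using ((hm q hq).1 c hc).map_smul r x
      beta_reduce
      rw [h.fderiv_eq, fderiv_const_mul (hd _ (by simp [hc]))]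
      rfl

namespace IsRegular

variable {g : V → V →L[ℝ] V →L[ℝ] ℝ} {U : Set V} {p : V}

lemma multiAt_cov (hg : IsRegular g U) {F : V → List V → ℝ} (hp : p ∈ U)
    (a : V) {n : ℕ} (hm : ∀ q ∈ U, MultiAt n (F q))
    (hd : ∀ L : List V, L.length = n → ContDiffOn ℝ ∞ (fun q => F q L) U) :
    MultiAt n (cov g F p a) :=
  (multiAt_fderiv hg.isOpen hp a hm fun L hL => ((hd L hL).contDiffAt
    (hg.isOpen.mem_nhds hp)).differentiableAt (by simp)).add
    ((hm p hp).der (isLinearMap_christoffel g p a))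

lemma isLinearMap_cov {F : V → List V → ℝ} (L : List V) (hm : MultiAt L.length (F p)) :
    IsLinearMap ℝ fun a => cov g F p a L := by
  have h1 : ∀ a b, der (christoffel g p (a + b)) (F p) L
      = der (christoffel g p a) (F p) L + der (christoffel g p b) (F p) L := fun a b => by
    rw [← der_add_endo _ _ _ hm]
    simp only [← christoffel_add_left]
  constructor
  · intro a b
    simp only [cov, map_add, h1]
    ring
  · intro r a
    have h2 : ∀ (L : List V) (F : List V → ℝ), MultiAt L.length F →
        der (christoffel g p (r • a)) F L = r * der (christoffel g p a) F L := by
      intro L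
      induction L with
      | nil => simp [der]
      | cons b c ih =>
        intro F hF
        simp only [der, christoffel_smul_left, (hF.1 c rfl).map_smul, ih _ (hF.2 b), smul_eq_mul]
        ring
    simp only [cov, map_smul, h2 L _ hm, smul_eq_mul]
    ring

lemma contDiffOn_cov (hg : IsRegular g U) {F : V → List V → ℝ} (a : V) (L : List V)
    (hm : ∀ q ∈ U, MultiAt L.length (F q))
    (hd : ∀ Q : List V, Q.length = L.length → ContDiffOn ℝ ∞ (fun q => F q Q) U) :
    ContDiffOn ℝ ∞ (fun p => cov g F p a L) U :=
  (((hd L rfl).fderiv_of_isOpen hg.isOpen (by simp)).clm_apply contDiffOn_const).add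
    (contDiffOn_der L hm hd fun v => hg.contDiffOn_christoffel a v)

lemma contDiffOn_riemann (hg : IsRegular g U) (u v w z : V) :
    ContDiffOn ℝ ∞ (fun p => riemann g p u v w z) U := by
  have hG := hg.contDiffOn_christoffelL
  have hd := hG.fderiv_of_isOpen hg.isOpen (m := ∞) (by simp)
  have hc : ∀ y : V, ContDiffOn ℝ ∞ (fun _ : V => y) U := fun y => contDiffOn_const
  refine ContDiffOn.congr (f := fun p => g p (curvatureOp g p u v w) z) ?_
    fun p hp => hg.riemann_eq hp u v w z
  refine (hg.smooth.contDiffOn.clm_apply ?_).clm_apply contDiffOn_const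
  exact (((((hd.clm_apply (hc u)).clm_apply (hc v)).clm_apply (hc w)).sub
    (((hd.clm_apply (hc v)).clm_apply (hc u)).clm_apply (hc w))).add
    ((hG.clm_apply (hc u)).clm_apply ((hG.clm_apply (hc v)).clm_apply (hc w)))).sub
    ((hG.clm_apply (hc v)).clm_apply ((hG.clm_apply (hc u)).clm_apply (hc w)))

lemma multiAt_riemann (hg : IsRegular g U) (hp : p ∈ U) :
    MultiAt 4 (flatten (jetField g p)) := by
  have hR : ∀ u v w z, riemann g p u v w z = g p (curvatureOp g p u v w) z := hg.riemann_eq hp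
  refine ⟨fun c hc => ?_, fun y₁ => ⟨fun c hc => ?_, fun y₂ => ⟨fun c hc => ?_, fun y₃ =>
    ⟨fun c hc => ?_, fun _ => trivial⟩⟩⟩⟩
  · obtain ⟨v, w, z, rfl⟩ := List.length_eq_three.1 hc
    constructor <;> intros <;> simp only [flatten, jetField, nablaRiemann, hR, curvatureOp,
      List.length_nil, map_add, map_sub, add_apply, sub_apply, map_smul, smul_apply, smul_eq_mul]
    all_goals ring
  · obtain ⟨w, z, rfl⟩ := List.length_eq_two.1 hc
    constructor <;> intros <;> simp only [flatten, jetField, nablaRiemann, hR, curvatureOp,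
      List.length_nil, map_add, map_sub, add_apply, sub_apply, map_smul, smul_apply, smul_eq_mul]
    all_goals ring
  · obtain ⟨z, rfl⟩ := List.length_eq_one_iff.1 hc
    constructor <;> intros <;> simp only [flatten, jetField, nablaRiemann, hR, curvatureOp,
      List.length_nil, map_add, map_sub, add_apply, sub_apply, map_smul, smul_apply, smul_eq_mul]
    all_goals ring
  · obtain rfl := List.length_eq_zero_iff.1 hc
    constructor <;> intros <;> simp only [flatten, jetField, nablaRiemann, hR,
      List.length_nil, map_add, map_smul, smul_eq_mul]

/-- Multilinearity and smoothness are proved together, since each at order `m + 1` uses both at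
order `m`. The new derivative direction is the fifth entry of the list; its linearity comes from
that of `cov` in the direction, that of the other entries from the previous order. -/
lemma jetField_regular (hg : IsRegular g U) (m : ℕ) :
    (∀ p ∈ U, MultiAt (m + 4) (flatten (jetField g p))) ∧
    ∀ L : List V, L.length = m + 4 → ContDiffOn ℝ ∞ (fun p => flatten (jetField g p) L) U := by
  induction m with
  | zero =>
    refine ⟨fun p hp => hg.multiAt_riemann hp, fun L hL => ?_⟩
    match L, hL with
    | [u, v, w, z], _ => exact hg.contDiffOn_riemann u v w z
  | succ m ih =>
    obtain ⟨hm, hd⟩ := ih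
    constructor
    · intro p hp
      have hG := fun a => hg.multiAt_cov (F := fun q => flatten (jetField g q)) hp a hm hd
      refine ⟨fun c hc => ?_, fun y₁ => ⟨fun c hc => ?_, fun y₂ => ⟨fun c hc => ?_, fun y₃ =>
        ⟨fun c hc => ?_, fun y₄ => ⟨fun c hc => ?_, fun a => ?_⟩⟩⟩⟩⟩
      · match c, hc with
        | y₂ :: y₃ :: y₄ :: a :: c, hc =>
          simp only [flatten_jetField_cons]
          exact (hG a).1 (y₂ :: y₃ :: y₄ :: c) (by simpa using hc)
      · match c, hc with
        | y₃ :: y₄ :: a :: c, hc =>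
          simp only [flatten_jetField_cons]
          exact ((hG a).2 y₁).1 (y₃ :: y₄ :: c) (by simpa using hc)
      · match c, hc with
        | y₄ :: a :: c, hc =>
          simp only [flatten_jetField_cons]
          exact (((hG a).2 y₁).2 y₂).1 (y₄ :: c) (by simpa using hc)
      · match c, hc with
        | a :: c, hc =>
          simp only [flatten_jetField_cons]
          exact ((((hG a).2 y₁).2 y₂).2 y₃).1 c (by simpa using hc)
      · simp only [flatten_jetField_cons]
        exact isLinearMap_cov (y₁ :: y₂ :: y₃ :: y₄ :: c) (by simpa [hc] using hm p hp)
      · simp only [flatten_jetField_cons]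
        exact ((((hG a).2 y₁).2 y₂).2 y₃).2 y₄
    · intro L hL
      match L, hL with
      | y₁ :: y₂ :: y₃ :: y₄ :: a :: c, hL =>
        simp only [flatten_jetField_cons]
        have hc : c.length = m := by simpa using hL
        exact hg.contDiffOn_cov a (y₁ :: y₂ :: y₃ :: y₄ :: c) (by simpa [hc] using hm)
          fun Q hQ => hd Q (by simpa [hc] using hQ)

lemma multiAt_jetField (hg : IsRegular g U) (hp : p ∈ U) (n : ℕ) :
    MultiAt n (flatten (jetField g p)) := by
  by_cases h : 4 ≤ n
  · obtain ⟨m, rfl⟩ := Nat.exists_eq_add_of_le' h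
    exact (hg.jetField_regular m).1 p hp
  · exact multiAt_flatten_of_lt _ (not_le.1 h)

lemma contDiffOn_jetField (hg : IsRegular g U) (c : List V) (y₁ y₂ y₃ y₄ : V) :
    ContDiffOn ℝ ∞ (fun p => jetField g p c y₁ y₂ y₃ y₄) U :=
  (hg.jetField_regular c.length).2 (y₁ :: y₂ :: y₃ :: y₄ :: c) (by simp)

lemma differentiableAt_jetField (hg : IsRegular g U) (hp : p ∈ U) (c : List V)
    (y₁ y₂ y₃ y₄ : V) : DifferentiableAt ℝ (fun p => jetField g p c y₁ y₂ y₃ y₄) p :=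
  ((hg.contDiffOn_jetField c y₁ y₂ y₃ y₄).contDiffAt (hg.isOpen.mem_nhds hp)).differentiableAt
    (by simp)

lemma eventually_line_mem (hg : IsRegular g U) (hp : p ∈ U) (a : V) :
    ∀ᶠ t : ℝ in 𝓝 0, p + t • a ∈ U := by
  have h : ContinuousAt (fun t : ℝ => p + t • a) 0 := by fun_prop
  exact h (hg.isOpen.mem_nhds (by simpa using hp))

end IsRegular

/-- Infinitesimal parallel transport from `p` in the direction `a`. -/
def transport (g : V → V →L[ℝ] V →L[ℝ] ℝ) (p a : V) (t : ℝ) : V →L[ℝ] V :=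
  ContinuousLinearMap.id ℝ V - t • christoffelL g p a

@[simp] lemma transport_zero (g : V → V →L[ℝ] V →L[ℝ] ℝ) (p a v : V) :
    transport g p a 0 v = v := by simp [transport]

lemma hasDerivAt_transport (g : V → V →L[ℝ] V →L[ℝ] ℝ) (p a : V) :
    HasDerivAt (transport g p a) (-christoffelL g p a) 0 :=
  (((hasDerivAt_id (0 : ℝ)).smul_const (christoffelL g p a)).const_sub
    (ContinuousLinearMap.id ℝ V)).congr_deriv (by simp)

lemma hasDerivAt_transport_apply (g : V → V →L[ℝ] V →L[ℝ] ℝ) (p a v : V) :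
    HasDerivAt (fun t => transport g p a t v) (-christoffel g p a v) 0 := by
  simpa using (hasDerivAt_transport g p a).clm_apply (hasDerivAt_const 0 v)

lemma hasDerivAt_line {F : Type*} [NormedAddCommGroup F] [NormedSpace ℝ F] {f : V → F}
    {f' : V →L[ℝ] F} {p : V} (a : V) (h : HasFDerivAt f f' p) :
    HasDerivAt (fun t : ℝ => f (p + t • a)) (f' a) 0 := by
  have h1 : HasDerivAt (fun t : ℝ => p + t • a) a 0 := by
    simpa using ((hasDerivAt_id (0 : ℝ)).smul_const a).const_add p
  have h2 : HasFDerivAt f f' (p + (0 : ℝ) • a) := by simpa using h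
  exact h2.comp_hasDerivAt 0 h1

namespace IsRegular

variable {g : V → V →L[ℝ] V →L[ℝ] ℝ} {U : Set V} {p : V}

/-- The covariant derivative as the derivative along infinitesimally parallel arguments. -/
lemma hasDerivAt_jetField (hg : IsRegular g U) (hp : p ∈ U) (a : V) (c : List V)
    (y₁ y₂ y₃ y₄ : V) :
    HasDerivAt (fun t : ℝ => jetField g (p + t • a) (c.map (transport g p a t))
      (transport g p a t y₁) (transport g p a t y₂) (transport g p a t y₃) (transport g p a t y₄))
      (jetField g p (a :: c) y₁ y₂ y₃ y₄) 0 := by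
  have h := hasDerivAt_list_map (φ := fun t => transport g p a t) (A := christoffel g p a)
    (F := fun t => flatten (jetField g (p + t • a)))
    (F' := fun Q => fderiv ℝ (fun q => flatten (jetField g q) Q) p a)
    (y₁ :: y₂ :: y₃ :: y₄ :: c)
    ((hg.eventually_line_mem hp a).mono fun t ht => hg.multiAt_jetField ht _)
    (fun Q hQ => hasDerivAt_line a (f := fun q => flatten (jetField g q) Q)
      ((((hg.jetField_regular c.length).2 Q (by simpa using hQ)).contDiffAt
      (hg.isOpen.mem_nhds hp)).differentiableAt (by simp)).hasFDerivAt)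
    (hasDerivAt_transport_apply g p a) (transport_zero g p a)
  refine h.congr_deriv ?_
  have := flatten_jetField_cons g p a c y₁ y₂ y₃ y₄
  rw [cov] at this
  simpa [flatten] using this.symm

/-! ### Symmetries of the iterated covariant derivatives -/

/-- The identities hold along `p + t a` on transported arguments, by induction, and can be
differentiated at `t = 0`. First-order transport is enough, so no transport equation has to be
solved. -/
lemma isAlgCurvature_jetField (hg : IsRegular g U) (n : ℕ) :
    ∀ p ∈ U, ∀ c : List V, c.length = n → IsAlgCurvature (jetField g p c) := by
  induction n with
  | zero =>
    intro p hp c hc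
    obtain rfl := List.length_eq_zero_iff.1 hc
    exact hg.isAlgCurvature_riemann hp
  | succ n ih =>
    intro p hp c hc
    match c, hc with
    | a :: c, hc =>
      have hD := hg.hasDerivAt_jetField hp a c
      have hU : ∀ᶠ t : ℝ in 𝓝 0, IsAlgCurvature (jetField g (p + t • a)
          (c.map (transport g p a t))) := by
        filter_upwards [hg.eventually_line_mem hp a] with t ht
        exact ih _ ht _ (by simpa using hc)
      constructor
      · intro x₁ x₂ y₁ y₂
        refine (hD _ _ _ _).unique (((hD x₂ x₁ y₁ y₂).fun_neg).congr_of_eventuallyEq ?_)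
        filter_upwards [hU] with t ht using ht.skew _ _ _ _
      · intro x₁ x₂ y₁ y₂
        refine (hD _ _ _ _).unique ((hD y₁ y₂ x₁ x₂).congr_of_eventuallyEq ?_)
        filter_upwards [hU] with t ht using ht.pair_symm _ _ _ _
      · intro x₁ x₂ x₃ y
        refine ((((hD x₁ x₂ x₃ y).fun_add (hD x₂ x₃ x₁ y)).fun_add (hD x₃ x₁ x₂ y))).unique
          ((hasDerivAt_const (0 : ℝ) (0 : ℝ)).congr_of_eventuallyEq ?_)
        filter_upwards [hU] with t ht using ht.bianchi₁ _ _ _ _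

/-- The slot taking part in the cyclic sum is the innermost derivative, so further derivatives are
prepended without disturbing it and the transport argument applies again. -/
lemma bianchi_jetField (hg : IsRegular g U) (n : ℕ) :
    ∀ p ∈ U, ∀ c : List V, c.length = n → ∀ x₁ x₂ x₃ y₁ y₂,
      jetField g p (c ++ [x₁]) x₂ x₃ y₁ y₂ + jetField g p (c ++ [x₂]) x₃ x₁ y₁ y₂
        + jetField g p (c ++ [x₃]) x₁ x₂ y₁ y₂ = 0 := by
  induction n with
  | zero =>
    intro p hp c hc x₁ x₂ x₃ y₁ y₂
    obtain rfl := List.length_eq_zero_iff.1 hc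
    refine hg.bianchi_riemann hp x₁ x₂ x₃ y₁ y₂ (fun x u v => jetField g p ([] ++ [x]) u v y₁ y₂)
      fun x u v => ?_
    rw [List.nil_append, jetField_cons]
    simp only [act, jetField, List.length_nil, nablaRiemann]
    ring
  | succ n ih =>
    intro p hp c hc x₁ x₂ x₃ y₁ y₂
    match c, hc with
    | a :: c, hc =>
      have hD := fun x => hg.hasDerivAt_jetField hp a (c ++ [x])
      refine ((((hD x₁ x₂ x₃ y₁ y₂).fun_add (hD x₂ x₃ x₁ y₁ y₂)).fun_add
          (hD x₃ x₁ x₂ y₁ y₂))).unique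
          ((hasDerivAt_const (0 : ℝ) (0 : ℝ)).congr_of_eventuallyEq ?_)
      filter_upwards [hg.eventually_line_mem hp a] with t ht
      simpa using ih _ ht (c.map (transport g p a t)) (by simpa using hc) _ _ _ _ _

end IsRegular

end

/-! ### Commuting covariant derivatives at every order. -/

section

variable {V : Type*} [NormedAddCommGroup V] [NormedSpace ℝ V] [FiniteDimensional ℝ V]

/-! ### The Ricci identities -/

lemma multiAt_flatten_cons {T : ListTensor V} (hT : ∀ n, MultiAt n (flatten T)) (b : V) (n : ℕ) :
    MultiAt n (flatten fun Q => T (b :: Q)) := by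
  rcases lt_or_ge n 4 with h | h
  · exact multiAt_flatten_of_lt _ h
  obtain ⟨m, rfl⟩ := Nat.exists_eq_add_of_le' h
  have hm := hT (m + 1 + 4)
  refine ⟨fun c hc => ?_, fun y₁ => ⟨fun c hc => ?_, fun y₂ => ⟨fun c hc => ?_, fun y₃ =>
    ⟨fun c hc => ?_, fun y₄ => ?_⟩⟩⟩⟩
  · match c, hc with
    | y₂ :: y₃ :: y₄ :: c, hc =>
      exact hm.1 (y₂ :: y₃ :: y₄ :: b :: c) (by simpa using hc)
  · match c, hc with
    | y₃ :: y₄ :: c, hc => exact (hm.2 y₁).1 (y₃ :: y₄ :: b :: c) (by simpa using hc)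
  · match c, hc with
    | y₄ :: c, hc => exact ((hm.2 y₁).2 y₂).1 (y₄ :: b :: c) (by simpa using hc)
  · exact (((hm.2 y₁).2 y₂).2 y₃).1 (b :: c) (by simpa using hc)
  · exact ((((hm.2 y₁).2 y₂).2 y₃).2 y₄).2 b

lemma multiAt_flatten_append {T : ListTensor V} (hT : ∀ n, MultiAt n (flatten T)) (P : List V)
    (n : ℕ) : MultiAt n (flatten fun Q => T (P ++ Q)) := by
  induction P generalizing T with
  | nil => exact hT n
  | cons b P ih => exact ih fun n => multiAt_flatten_cons hT b n

lemma MultiAt.comp_map {n : ℕ} {F : List V → ℝ} (hF : MultiAt n F) (φ : V →L[ℝ] V) :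
    MultiAt n fun L => F (L.map φ) := by
  induction n generalizing F with
  | zero => trivial
  | succ n ih =>
    refine ⟨fun c hc => ⟨fun x y => ?_, fun r x => ?_⟩, fun b => ih (hF.2 (φ b))⟩
    · simp only [List.map_cons, map_add]
      exact (hF.1 (c.map φ) (by simpa using hc)).map_add _ _
    · simp only [List.map_cons, map_smul]
      exact (hF.1 (c.map φ) (by simpa using hc)).map_smul _ _

lemma fderiv_fderiv_swap {U : Set V} (hU : IsOpen U) {f : V → ℝ} (hf : ContDiffOn ℝ ∞ f U)
    {p : V} (hp : p ∈ U) (x y : V) :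
    fderiv ℝ (fun q => fderiv ℝ f q y) p x = fderiv ℝ (fun q => fderiv ℝ f q x) p y := by
  have hc := hf.contDiffAt (hU.mem_nhds hp)
  have hd : HasFDerivAt (fderiv ℝ f) (fderiv ℝ (fderiv ℝ f) p) p :=
    ((hc.fderiv_right (m := ∞) (by simp)).differentiableAt (by simp)).hasFDerivAt
  have h : ∀ x y, fderiv ℝ (fun q => fderiv ℝ f q y) p x = fderiv ℝ (fderiv ℝ f) p x y := by
    intro x y
    rw [(hd.clm_apply (hasFDerivAt_const y p)).fderiv]
    simp
  rw [h, h, (hc.isSymmSndFDerivAt (by simpa using two_le_infty)).eq]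

/-- A linear functional as a continuous one. -/
def dualOf (f : V → ℝ) : V →L[ℝ] ℝ := by
  classical
  exact if h : IsLinearMap ℝ f then LinearMap.toContinuousLinearMap (h.mk' f) else 0

lemma dualOf_apply {f : V → ℝ} (h : IsLinearMap ℝ f) (v : V) : dualOf f v = f v := by
  simp [dualOf, h]

/-- The endomorphisms `(∇_P R)(x, y)` of a metric. -/
def nablaCurvatureOp (g : V → V →L[ℝ] V →L[ℝ] ℝ) (p x y : V) (P : List V) (u : V) : V :=
  (g p).inverse (dualOf fun w => jetField g p P x y u w)

lemma hasDerivAt_clm_of_apply {θ : ℝ → V →L[ℝ] ℝ} {θ' : V →L[ℝ] ℝ}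
    (h : ∀ v, HasDerivAt (fun t => θ t v) (θ' v) 0) : HasDerivAt θ θ' 0 := by
  have key : ∀ f : V →L[ℝ] ℝ, f = ∑ i, f (Module.finBasis ℝ V i) •
      LinearMap.toContinuousLinearMap ((Module.finBasis ℝ V).coord i) := by
    intro f
    ext v
    refine (IsLinearMap.eq_sum_coord f.toLinearMap.isLinear v).trans ?_
    simp [mul_comm]
  rw [key θ', show θ = _ from funext fun t => key (θ t)]
  exact HasDerivAt.fun_sum fun i _ => (h _).smul_const _

namespace IsRegular

variable {g : V → V →L[ℝ] V →L[ℝ] ℝ} {U : Set V} {p : V}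

lemma isLinearMap_jetField (hg : IsRegular g U) (hp : p ∈ U) (c : List V) (x y u : V) :
    IsLinearMap ℝ fun w => jetField g p c x y u w :=
  ((((hg.multiAt_jetField hp (c.length + 4)).2 x).2 y).2 u).1 c rfl

lemma apply_nablaCurvatureOp (hg : IsRegular g U) (hp : p ∈ U) (x y : V) (P : List V) (u w : V) :
    g p (nablaCurvatureOp g p x y P u) w = jetField g p P x y u w := by
  rw [nablaCurvatureOp, (hg.inv p hp).self_apply_inverse,
    dualOf_apply (hg.isLinearMap_jetField hp P x y u)]

lemma nablaCurvatureOp_nil (hg : IsRegular g U) (hp : p ∈ U) (x y u : V) :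
    nablaCurvatureOp g p x y [] u = curvatureOp g p x y u :=
  hg.ext hp fun w => by
    rw [hg.apply_nablaCurvatureOp hp, ← hg.riemann_eq hp]
    rfl

/-- The second covariant derivative is arranged so that its antisymmetric part in `x, y` can be read
off: only the term with `∂_x Γ(y, ·)` and the iterated action of `Γ` contribute. The last term, from
`Γ(x, ·)` acting on the slot `y`, is symmetric by absence of torsion. -/
lemma jetField_cons_cons (hg : IsRegular g U) (hp : p ∈ U) (x y : V) (c : List V)
    (y₁ y₂ y₃ y₄ : V) (F : V → List V → ℝ) (hF : F = fun q => flatten (jetField g q))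
    (L : List V) (hL : L = y₁ :: y₂ :: y₃ :: y₄ :: c) :
    jetField g p (x :: y :: c) y₁ y₂ y₃ y₄ =
      fderiv ℝ (fun q => fderiv ℝ (fun q => F q L) q y) p x
      + der (fderiv ℝ (christoffelL g) p x y) (F p) L
      + der (christoffel g p y) (fun Q => fderiv ℝ (fun q => F q Q) p x) L
      + der (christoffel g p x) (fun Q => fderiv ℝ (fun q => F q Q) p y) L
      + der (christoffel g p x) (der (christoffel g p y) (F p)) L
      - jetField g p (christoffel g p x y :: c) y₁ y₂ y₃ y₄ := by
  have hsm : ∀ Q : List V, Q.length = L.length → ContDiffOn ℝ ∞ (fun q => F q Q) U := by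
    subst hF hL
    exact fun Q hQ => (hg.jetField_regular c.length).2 Q (by simpa using hQ)
  have hdiff : ∀ Q : List V, Q.length = L.length →
      HasFDerivAt (fun q => F q Q) (fderiv ℝ (fun q => F q Q) p) p := fun Q hQ =>
    (((hsm Q hQ).contDiffAt (hg.isOpen.mem_nhds hp)).differentiableAt (by simp)).hasFDerivAt
  have hm : ∀ q ∈ U, MultiAt L.length (F q) := by
    subst hF
    exact fun q hq => hg.multiAt_jetField hq _
  have h1 : ∀ y q, jetField g q (y :: c) y₁ y₂ y₃ y₄ = cov g F q y L := by
    subst hF hL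
    exact fun y q => flatten_jetField_cons g q y c y₁ y₂ y₃ y₄
  have h2 : act (christoffel g p x) (fun Q => jetField g p (y :: Q)) c y₁ y₂ y₃ y₄
      = der (christoffel g p x) (cov g F p y) L := by
    rw [← der_flatten, ← hL]
    refine der_congr _ _ fun Q hQ => ?_
    subst hF hL
    match Q, hQ with
    | z₁ :: z₂ :: z₃ :: z₄ :: Q, _ => exact flatten_jetField_cons g p y Q z₁ z₂ z₃ z₄
  have h3 : HasDerivAt (fun t : ℝ => cov g F (p + t • x) y L)
      (fderiv ℝ (fun q => fderiv ℝ (fun q => F q L) q y) p x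
      + (der (fderiv ℝ (christoffelL g) p x y) (F p) L
      + der (christoffel g p y) (fun Q => fderiv ℝ (fun q => F q Q) p x) L)) 0 := by
    have hs : HasFDerivAt (fun q => fderiv ℝ (fun q => F q L) q y)
        (fderiv ℝ (fun q => fderiv ℝ (fun q => F q L) q y) p) p :=
      (((((hsm L rfl).fderiv_of_isOpen hg.isOpen (m := ∞) (by simp)).clm_apply
        contDiffOn_const).contDiffAt (hg.isOpen.mem_nhds hp)).differentiableAt
        (by simp)).hasFDerivAt
    have hder := hasDerivAt_der (A := fun t => christoffel g (p + t • x) y)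
      (A' := fderiv ℝ (christoffelL g) p x y) (F := fun t => F (p + t • x))
      (F' := fun Q => fderiv ℝ (fun q => F q Q) p x) L
      ((hg.eventually_line_mem hp x).mono fun t ht => hm _ ht)
      (fun Q hQ => hasDerivAt_line x (hdiff Q hQ)) (fun v => by
        have h := hasDerivAt_line x ((((hg.hasFDerivAt_christoffelL hp).clm_apply
          (hasFDerivAt_const y p))).clm_apply (hasFDerivAt_const v p))
        simpa using h)
    refine ((hasDerivAt_line x hs).fun_add hder).congr_deriv ?_
    simp
  have h4 : DifferentiableAt ℝ (fun q => cov g F q y L) p := by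
    have := hg.differentiableAt_jetField hp (y :: c) y₁ y₂ y₃ y₄
    simpa only [h1] using this
  rw [jetField_cons, act, h2]
  simp only [h1]
  rw [(hasDerivAt_line x h4.hasFDerivAt).unique h3]
  simp only [show cov g F p y = fun Q => fderiv ℝ (fun q => F q Q) p y
    + der (christoffel g p y) (F p) Q from rfl, der_add]
  ring

/-- After the symmetric terms cancel, what acts is `∂_x Γ(y, ·) - ∂_y Γ(x, ·) + [Γ(x, ·), Γ(y, ·)]`,
the curvature operator; the commutator comes from `der_comm`. -/
lemma ricci_jetField_nil (hg : IsRegular g U) (hp : p ∈ U) (x y : V) (c : List V)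
    (y₁ y₂ y₃ y₄ : V) :
    jetField g p (x :: y :: c) y₁ y₂ y₃ y₄ - jetField g p (y :: x :: c) y₁ y₂ y₃ y₄
      = act (nablaCurvatureOp g p x y []) (jetField g p) c y₁ y₂ y₃ y₄ := by
  rw [hg.jetField_cons_cons hp x y c y₁ y₂ y₃ y₄ _ rfl _ rfl,
    hg.jetField_cons_cons hp y x c y₁ y₂ y₃ y₄ _ rfl _ rfl, hg.christoffel_comm p y x,
    fderiv_fderiv_swap hg.isOpen (f := fun q => flatten (jetField g q) (y₁ :: y₂ :: y₃ :: y₄ :: c))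
      (hg.contDiffOn_jetField c y₁ y₂ y₃ y₄) hp x y,
    ← der_flatten, show nablaCurvatureOp g p x y [] = fun v =>
      (fderiv ℝ (christoffelL g) p x y v + -fderiv ℝ (christoffelL g) p y x v)
        + (christoffel g p x (christoffel g p y v) - christoffel g p y (christoffel g p x v)) from
      funext fun v => by
        rw [hg.nablaCurvatureOp_nil hp, curvatureOp]
        simp only [christoffelL_apply]
        abel]
  have hm := hg.multiAt_jetField hp (y₁ :: y₂ :: y₃ :: y₄ :: c).length
  rw [der_add_endo _ _ _ hm, der_add_endo _ _ _ hm, der_neg_endo _ _ hm, ← der_comm _ hm]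
  ring

/-- The metric is infinitesimally invariant under parallel transport. -/
lemma hasDerivAt_transport_metric (hg : IsRegular g U) (hp : p ∈ U) (a : V) :
    HasDerivAt (fun t : ℝ => ((ContinuousLinearMap.compL ℝ V V ℝ).flip (transport g p a t)) ∘L
      (g (p + t • a) ∘L transport g p a t)) 0 0 := by
  have h1 := hasDerivAt_transport g p a
  have h2 := hasDerivAt_line a (hg.differentiableAt p).hasFDerivAt
  have h3 := (((ContinuousLinearMap.compL ℝ V V ℝ).flip.hasFDerivAt).comp_hasDerivAt (0 : ℝ)
    h1).clm_comp (h2.clm_comp h1)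
  refine h3.congr_deriv ?_
  ext u v
  simp [hg.fderiv_eq hp]

/-- The Ricci identity and all its covariant derivatives. -/
lemma ricci_jetField (hg : IsRegular g U) (n : ℕ) :
    ∀ p ∈ U, ∀ a : List V, a.length = n → ∀ (x y : V) (c : List V) (y₁ y₂ y₃ y₄ : V),
      jetField g p (a ++ x :: y :: c) y₁ y₂ y₃ y₄ - jetField g p (a ++ y :: x :: c) y₁ y₂ y₃ y₄
        = leibniz (nablaCurvatureOp g p x y) (jetField g p) a c y₁ y₂ y₃ y₄ := by
  induction n with
  | zero =>
    intro p hp a ha x y c y₁ y₂ y₃ y₄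
    obtain rfl := List.length_eq_zero_iff.1 ha
    exact hg.ricci_jetField_nil hp x y c y₁ y₂ y₃ y₄
  | succ n ih =>
    intro p hp a ha x y c y₁ y₂ y₃ y₄
    match a, ha with
    | b :: a, ha =>
    set φ := transport g p b with hφ
    -- `S t` and `G t` are the jet and the metric at `p + t b` pulled back by the transport `φ t`.
    -- At `t = 0` the derivative of `S` is the covariant derivative along `b`, and that of `G` is
    -- zero.
    set S : ℝ → ListTensor V := fun t Q z₁ z₂ z₃ z₄ =>
      jetField g (p + t • b) (Q.map (φ t)) (φ t z₁) (φ t z₂) (φ t z₃) (φ t z₄) with hS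
    set G : ℝ → V →L[ℝ] V →L[ℝ] ℝ := fun t =>
      ((ContinuousLinearMap.compL ℝ V V ℝ).flip (φ t)) ∘L (g (p + t • b) ∘L φ t) with hG
    have hG' : HasDerivAt G 0 0 := hg.hasDerivAt_transport_metric hp b
    have hG0 : G 0 = g p := by ext; simp [hG, hφ]
    have hGa : ∀ t u v, G t u v = g (p + t • b) (φ t u) (φ t v) := fun t u v => rfl
    have hSlin : ∀ t, p + t • b ∈ U → ∀ P x y u, IsLinearMap ℝ fun w => S t P x y u w := by
      intro t ht P x y u
      have h := hg.isLinearMap_jetField ht (P.map (φ t)) (φ t x) (φ t y) (φ t u)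
      exact ⟨fun v w => by simp only [hS, map_add]; exact h.map_add _ _,
        fun r v => by simp only [hS, map_smul]; exact h.map_smul _ _⟩
    have hS' : ∀ Q z₁ z₂ z₃ z₄, HasDerivAt (fun t => S t Q z₁ z₂ z₃ z₄)
        (jetField g p (b :: Q) z₁ z₂ z₃ z₄) 0 := hg.hasDerivAt_jetField hp b
    have hS0 : S 0 = jetField g p := by
      have h0 : ⇑(φ 0) = id := funext (transport_zero g p b)
      funext Q z₁ z₂ z₃ z₄
      simp [hS, h0]
    -- The curvature endomorphism formed from pulled-back data: it is conjugate by `φ t` to the one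
    -- at `p + t b`, but needs no inverse of `φ t`.
    set A : ℝ → List V → V → V := fun t P u =>
      (G t).inverse (dualOf fun w => S t P x y u w) with hA
    have hA0 : A 0 = nablaCurvatureOp g p x y := by
      funext P u
      simp only [hA, hG0, hS0]
      rfl
    have hline := hg.eventually_line_mem hp b
    have hA' : ∀ P u, HasDerivAt (fun t => A t P u) (nablaCurvatureOp g p x y (b :: P) u) 0 := by
      intro P u
      have h1 : HasDerivAt (fun t => dualOf fun w => S t P x y u w)
          (dualOf fun w => jetField g p (b :: P) x y u w) 0 := by
        refine hasDerivAt_clm_of_apply fun v => ?_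
        rw [dualOf_apply (hg.isLinearMap_jetField hp (b :: P) x y u)]
        refine (hS' P x y u v).congr_of_eventuallyEq ?_
        filter_upwards [hline] with t ht using dualOf_apply (hSlin t ht P x y u) v
      -- As `G` is stationary, so is its inverse; raising the index commutes with the covariant
      -- derivative.
      have h2 : HasDerivAt (fun t => (G t).inverse) 0 0 := by
        have h3 : DifferentiableAt ℝ ContinuousLinearMap.inverse (G 0) := by
          rw [hG0]
          exact ((hg.inv p hp).contDiffAt_map_inverse (n := 1)).differentiableAt (by simp)
        exact (h3.hasFDerivAt.comp_hasDerivAt 0 hG').congr_deriv (by simp)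
      refine (h2.clm_apply h1).congr_deriv ?_
      rw [hG0]
      simp [nablaCurvatureOp]
    have hinv : ∀ᶠ t in 𝓝 0, (G t).IsInvertible :=
      hG'.continuousAt.eventually (eventually_isInvertible (hG0 ▸ hg.inv p hp))
    have hnat : ∀ᶠ t in 𝓝 0, ∀ P u,
        nablaCurvatureOp g (p + t • b) (φ t x) (φ t y) (P.map (φ t)) (φ t u) = φ t (A t P u) := by
      filter_upwards [hline, hinv] with t ht hGt P u
      -- Nondegeneracy of the pullback `G t` forces `φ t` to be injective, hence surjective, so
      -- testing against the vectors `φ t w` suffices.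
      have hinj : Function.Injective (φ t : V →ₗ[ℝ] V) := by
        rw [← LinearMap.ker_eq_bot, LinearMap.ker_eq_bot']
        intro v hv
        refine hGt.injective ?_
        ext w
        have hv' : φ t v = 0 := hv
        simp [hGa, hv']
      refine hg.ext ht fun w => ?_
      obtain ⟨w, rfl⟩ := LinearMap.injective_iff_surjective.1 hinj w
      have h1 : G t (A t P u) w = S t P x y u w := by
        rw [hA, hGt.self_apply_inverse, dualOf_apply (hSlin t ht P x y u)]
      rw [hg.apply_nablaCurvatureOp ht]
      exact h1.symm
    have hm : ∀ᶠ t in 𝓝 0, ∀ P n, MultiAt n (flatten fun Q => S t (P ++ Q)) := by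
      filter_upwards [hline] with t ht P n
      refine multiAt_flatten_append (fun n => ?_) P n
      refine ((hg.multiAt_jetField ht n).comp_map (φ t)).congr fun Q _ => ?_
      match Q with
      | [] => rfl
      | [_] => rfl
      | [_, _] => rfl
      | [_, _, _] => rfl
      | _ :: _ :: _ :: _ :: _ => rfl
    have hL := hasDerivAt_leibniz a c y₁ y₂ y₃ y₄ hm hS' hA'
    rw [hA0, hS0] at hL
    -- The derivative in `hL` is a sum of two expansions, with `b` prepended to the arguments of the
    -- endomorphism or of the tensor. That is by definition the expansion for `b :: a`.
    refine ((hS' (a ++ x :: y :: c) y₁ y₂ y₃ y₄).fun_sub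
      (hS' (a ++ y :: x :: c) y₁ y₂ y₃ y₄)).unique (hL.congr_of_eventuallyEq ?_)
    filter_upwards [hline, hnat] with t ht hn
    rw [hS, ← leibniz_map hn]
    simpa using ih _ ht (a.map (φ t)) (by simpa using ha) (φ t x) (φ t y) (c.map (φ t))
      (φ t y₁) (φ t y₂) (φ t y₃) (φ t y₄)

end IsRegular

end

/-! ### Order of vanishing, and the effect of a small perturbation on the curvature jet. -/

section

variable {V : Type*} [NormedAddCommGroup V] [NormedSpace ℝ V]

/-! ### Functions vanishing to a given order at the origin -/

section Flat

variable {F F' : Type*} [NormedAddCommGroup F] [NormedSpace ℝ F]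
  [NormedAddCommGroup F'] [NormedSpace ℝ F']

/-- `f` is smooth on `U` and vanishes to order `m` at the origin: all derivatives of order less
than `m` are zero there. -/
def Flat (U : Set V) : ℕ → (V → F) → Prop
  | 0, f => ContDiffOn ℝ ∞ f U
  | m + 1, f => ContDiffOn ℝ ∞ f U ∧ f 0 = 0 ∧ ∀ a, Flat U m fun q => fderiv ℝ f q a

variable {U : Set V} {m : ℕ} {f g : V → F}

lemma Flat.contDiffOn (hf : Flat U m f) : ContDiffOn ℝ ∞ f U := by
  cases m with
  | zero => exact hf
  | succ m => exact hf.1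

lemma _root_.ContDiffOn.differentiableAt_of_isOpen (hf : ContDiffOn ℝ ∞ f U) (hU : IsOpen U)
    {p : V} (hp : p ∈ U) : DifferentiableAt ℝ f p :=
  (hf.contDiffAt (hU.mem_nhds hp)).differentiableAt (by simp)

lemma _root_.ContDiffOn.fderiv_apply_of_isOpen (hf : ContDiffOn ℝ ∞ f U) (hU : IsOpen U)
    (a : V) : ContDiffOn ℝ ∞ (fun q => fderiv ℝ f q a) U :=
  (hf.fderiv_of_isOpen hU (by simp)).clm_apply contDiffOn_const

lemma Flat.of_succ (hf : Flat U (m + 1) f) : Flat U m f := by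
  induction m generalizing f with
  | zero => exact hf.contDiffOn
  | succ m ih => exact ⟨hf.1, hf.2.1, fun a => ih (hf.2.2 a)⟩

lemma Flat.mono {n : ℕ} (hf : Flat U n f) (h : m ≤ n) : Flat U m f := by
  induction n with
  | zero => rwa [Nat.le_zero.1 h]
  | succ n ih =>
    rcases Nat.lt_or_eq_of_le h with h | rfl
    · exact ih (hf.of_succ) (Nat.lt_succ_iff.1 h)
    · exact hf

lemma Flat.congr (hU : IsOpen U) (h0 : (0 : V) ∈ U) (hf : Flat U m f) (h : EqOn g f U) :
    Flat U m g := by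
  induction m generalizing f g with
  | zero => exact ContDiffOn.congr hf h
  | succ m ih =>
    refine ⟨hf.1.congr h, (h h0).trans hf.2.1, fun a => ih (hf.2.2 a) fun q hq => ?_⟩
    have : g =ᶠ[𝓝 q] f := by filter_upwards [hU.mem_nhds hq] with x hx using h hx
    simp only [this.fderiv_eq]

lemma Flat.add (hU : IsOpen U) (h0 : (0 : V) ∈ U) (hf : Flat U m f) (hg : Flat U m g) :
    Flat U m fun q => f q + g q := by
  induction m generalizing f g with
  | zero => exact ContDiffOn.add hf hg
  | succ m ih =>
    refine ⟨hf.1.add hg.1, by simp [hf.2.1, hg.2.1], fun a =>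
      (ih (hf.2.2 a) (hg.2.2 a)).congr hU h0 fun q hq => ?_⟩
    rw [fderiv_fun_add (hf.1.differentiableAt_of_isOpen hU hq)
      (hg.1.differentiableAt_of_isOpen hU hq)]
    rfl

lemma Flat.clm (hU : IsOpen U) (h0 : (0 : V) ∈ U) (L : F →L[ℝ] F') (hf : Flat U m f) :
    Flat U m fun q => L (f q) := by
  induction m generalizing f with
  | zero => exact L.contDiff.comp_contDiffOn hf
  | succ m ih =>
    refine ⟨L.contDiff.comp_contDiffOn hf.1, by simp [hf.2.1], fun a =>
      (ih (hf.2.2 a)).congr hU h0 fun q hq => ?_⟩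
    rw [show (fun q => L (f q)) = L ∘ f from rfl, (L.hasFDerivAt.comp q (hf.1.differentiableAt_of_isOpen hU hq).hasFDerivAt).fderiv]
    rfl

lemma Flat.const_mul (hU : IsOpen U) (h0 : (0 : V) ∈ U) (r : ℝ) {f : V → ℝ} (hf : Flat U m f) :
    Flat U m fun q => r * f q :=
  hf.clm hU h0 (ContinuousLinearMap.mul ℝ ℝ r)

lemma Flat.neg (hU : IsOpen U) (h0 : (0 : V) ∈ U) (hf : Flat U m f) : Flat U m fun q => -f q :=
  hf.clm hU h0 (-ContinuousLinearMap.id ℝ F)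

lemma Flat.sub (hU : IsOpen U) (h0 : (0 : V) ∈ U) (hf : Flat U m f) (hg : Flat U m g) :
    Flat U m fun q => f q - g q := by
  simpa only [sub_eq_add_neg] using hf.add hU h0 (hg.neg hU h0)

lemma Flat.zero (m : ℕ) : Flat U m fun _ : V => (0 : F) := by
  induction m with
  | zero => exact contDiffOn_const
  | succ m ih => exact ⟨contDiffOn_const, rfl, fun a => by simpa using ih⟩

lemma Flat.sum (hU : IsOpen U) (h0 : (0 : V) ∈ U) {ι : Type*} (s : Finset ι) {f : ι → V → F}
    (hf : ∀ i ∈ s, Flat U m (f i)) : Flat U m fun q => ∑ i ∈ s, f i q := by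
  classical
  induction s using Finset.induction_on with
  | empty => simpa using Flat.zero m
  | insert i s hi ih =>
    simp only [Finset.sum_insert hi]
    exact (hf i (by simp)).add hU h0 (ih fun j hj => hf j (by simp [hj]))

lemma Flat.smul (hU : IsOpen U) (h0 : (0 : V) ∈ U) {f : V → ℝ} {w : V → F} (hf : Flat U m f)
    (hw : ContDiffOn ℝ ∞ w U) : Flat U m fun q => f q • w q := by
  induction m generalizing f w with
  | zero => exact ContDiffOn.smul hf hw
  | succ m ih =>
    refine ⟨hf.1.smul hw, by simp [hf.2.1], fun a =>
      ((ih (hf.2.2 a) hw).add hU h0 (ih (hf.of_succ)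
        (hw.fderiv_apply_of_isOpen hU a))).congr hU h0 fun q hq => ?_⟩
    rw [fderiv_fun_smul (hf.1.differentiableAt_of_isOpen hU hq)
      (hw.differentiableAt_of_isOpen hU hq)]
    simp [add_comm]

variable [FiniteDimensional ℝ V]

lemma flat_slot_left (hU : IsOpen U) (h0 : (0 : V) ∈ U) {L : V → V → ℝ} {w : V → V}
    (hlin : ∀ p ∈ U, IsLinearMap ℝ (L p)) (hL : ∀ v, Flat U m fun p => L p v)
    (hw : ContDiffOn ℝ ∞ w U) : Flat U m fun p => L p (w p) := by
  refine Flat.congr hU h0 (f := fun p => ∑ i, L p (Module.finBasis ℝ V i) *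
      (LinearMap.toContinuousLinearMap ((Module.finBasis ℝ V).coord i)) (w p)) ?_ fun p hp => ?_
  · exact Flat.sum hU h0 _ fun i _ => (hL _).smul hU h0
      ((ContinuousLinearMap.contDiff _).comp_contDiffOn hw)
  · simp only [mul_comm (L p _)]
    exact IsLinearMap.eq_sum_coord (hlin p hp) (w p)

lemma flat_slot_right (hU : IsOpen U) (h0 : (0 : V) ∈ U) {L : V → V → ℝ} {w : V → V}
    (hlin : ∀ p ∈ U, IsLinearMap ℝ (L p)) (hL : ∀ v, ContDiffOn ℝ ∞ (fun p => L p v) U)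
    (hw : Flat U m w) : Flat U m fun p => L p (w p) := by
  refine Flat.congr hU h0 (f := fun p => ∑ i,
      (LinearMap.toContinuousLinearMap ((Module.finBasis ℝ V).coord i)) (w p)
        * L p (Module.finBasis ℝ V i)) ?_ fun p hp => IsLinearMap.eq_sum_coord (hlin p hp) (w p)
  exact Flat.sum hU h0 _ fun i _ => (hw.clm hU h0 _).smul hU h0 (hL _)

/-- Slot by slot, `F'(A' b) - F(A b) = F'((A' - A) b) + (F' - F)(A b)`, and in each summand one
factor vanishes to order `m`. -/
lemma flat_der_sub (hU : IsOpen U) (h0 : (0 : V) ∈ U) {A A' : V → V → V} {F F' : V → List V → ℝ}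
    (L : List V) (hm : ∀ p ∈ U, MultiAt L.length (F p)) (hm' : ∀ p ∈ U, MultiAt L.length (F' p))
    (hF' : ∀ Q : List V, Q.length = L.length → ContDiffOn ℝ ∞ (fun p => F' p Q) U)
    (hA : ∀ v, ContDiffOn ℝ ∞ (fun p => A p v) U)
    (hFF : ∀ Q : List V, Q.length = L.length → Flat U m fun p => F' p Q - F p Q)
    (hAA : ∀ v, Flat U m fun p => A' p v - A p v) :
    Flat U m fun p => der (A' p) (F' p) L - der (A p) (F p) L := by
  induction L generalizing F F' with
  | nil => simpa [der] using Flat.zero m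
  | cons b c ih =>
    have h1 := flat_slot_right hU h0 (L := fun p v => F' p (v :: c))
      (fun p hp => (hm' p hp).1 c rfl) (fun v => hF' _ (by simp)) (hAA b)
    have h2 := flat_slot_left hU h0 (L := fun p v => F' p (v :: c) - F p (v :: c))
      (fun p hp => ⟨fun x y => by
          rw [((hm' p hp).1 c rfl).map_add, ((hm p hp).1 c rfl).map_add]; ring,
        fun r x => by
          rw [((hm' p hp).1 c rfl).map_smul, ((hm p hp).1 c rfl).map_smul, smul_sub]⟩)
      (fun v => hFF _ (by simp)) (hA b)
    have h3 := ih (F := fun p Q => F p (b :: Q)) (F' := fun p Q => F' p (b :: Q))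
      (fun p hp => (hm p hp).2 b) (fun p hp => (hm' p hp).2 b) (fun Q hQ => hF' _ (by simp [hQ]))
      (fun Q hQ => hFF _ (by simp [hQ]))
    refine ((h3.sub hU h0 h1).sub hU h0 h2).congr hU h0 fun p hp => ?_
    simp only [der]
    rw [((hm' p hp).1 c rfl).map_sub]
    ring

end Flat

variable [FiniteDimensional ℝ V]

/-! ### Perturbations of a metric -/

/-- Iterated directional derivatives. -/
def iterDir (f : V → ℝ) : List V → V → ℝ
  | [] => f
  | a :: c => fun p => fderiv ℝ (iterDir f c) p a

lemma Flat.iterDir {U : Set V} {m : ℕ} {f : V → ℝ} (c : List V) (hf : Flat U (m + c.length) f) :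
    Flat U m (iterDir f c) := by
  induction c generalizing m with
  | nil => exact hf
  | cons a c ih => exact (ih (m := m + 1) (by convert hf using 1; simp; ring)).2.2 a

/-- The linearization of the curvature tensor in the direction `h` at the flat metric. -/
def linearizedCurvature (h : V → V →L[ℝ] V →L[ℝ] ℝ) (u v w z p : V) : ℝ :=
  linearCurvature (fun a b c d => fderiv ℝ (fun q => fderiv ℝ (fun q' => h q' c d) q b) p a) u v w z

lemma flat_linearizedCurvature {U : Set V} (hU : IsOpen U) (h0 : (0 : V) ∈ U) {m : ℕ}
    {h : V → V →L[ℝ] V →L[ℝ] ℝ} (hh : ∀ y z, Flat U (m + 2) fun p => h p y z) (u v w z : V) :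
    Flat U m (linearizedCurvature h u v w z) := by
  have hD : ∀ a b c d, Flat U m fun p =>
      fderiv ℝ (fun q => fderiv ℝ (fun q' => h q' c d) q b) p a :=
    fun a b c d => ((hh c d).2.2 b).2.2 a
  refine Flat.congr hU h0 (((((hD u w v z).sub hU h0 (hD u z v w)).sub hU h0
    (hD v w u z)).add hU h0 (hD v z u w)).const_mul hU h0 (1 / 2)) fun p hp => ?_
  simp only [linearizedCurvature, linearCurvature]
  ring

lemma fderiv_apply_apply {g : V → V →L[ℝ] V →L[ℝ] ℝ} (hg : ContDiff ℝ ∞ g) (p u v w : V) :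
    fderiv ℝ g p u v w = fderiv ℝ (fun q => g q v w) p u := by
  rw [((((hg.differentiable (by simp) p).hasFDerivAt).clm_apply (hasFDerivAt_const v p)).clm_apply
    (hasFDerivAt_const w p)).fderiv]
  simp

namespace IsRegular

variable {g h : V → V →L[ℝ] V →L[ℝ] ℝ} {U : Set V} {k : ℕ}

/-- Subtracting the two Koszul formulas leaves first derivatives of `h` and a term `h(Γ, ·)`, so one
order of vanishing is lost. -/
lemma flat_christoffel_sub (hg : IsRegular g U) (hg' : IsRegular (fun p => g p + h p) U)
    (h0 : (0 : V) ∈ U) (hs : ContDiff ℝ ∞ h) (hh : ∀ y z, Flat U (k + 2) fun p => h p y z)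
    (u v : V) :
    Flat U (k + 1) fun p => christoffel (fun p => g p + h p) p u v - christoffel g p u v := by
  have hU := hg.isOpen
  have hsum : ∀ p a b c, fderiv ℝ (fun p => g p + h p) p a b c
      = fderiv ℝ g p a b c + fderiv ℝ (fun q => h q b c) p a := by
    intro p a b c
    rw [fderiv_fun_add (hg.differentiableAt p) (hs.differentiable (by simp) p),
      ← fderiv_apply_apply hs]
    rfl
  -- The value of `(g + h)(Γ' - Γ, w)`, where `Γ'` belongs to `g + h`. The difference `Γ' - Γ` is
  -- recovered below by raising the index with the smooth inverse of `g + h`.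
  set η : V → V → ℝ := fun w p => (fderiv ℝ (fun q => h q v w) p u
    + fderiv ℝ (fun q => h q u w) p v - fderiv ℝ (fun q => h q u v) p w) * (1 / 2)
    - h p (christoffel g p u v) w with hη
  have hηf : ∀ w, Flat U (k + 1) (η w) := by
    intro w
    refine Flat.sub hU h0 ?_ ?_
    · exact ((((hh v w).2.2 u).add hU h0 ((hh u w).2.2 v)).sub hU h0 ((hh u v).2.2 w)).smul hU h0
        contDiffOn_const
    · exact flat_slot_left hU h0 (L := fun p y => h p y w)
        (fun p _ => ⟨fun x y => by simp, fun r x => by simp⟩)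
        (fun y => (hh y w).of_succ) (hg.contDiffOn_christoffel u v)
  refine Flat.congr hU h0 (f := fun p => ∑ i, η (Module.finBasis ℝ V i) p •
    (g p + h p).inverse (LinearMap.toContinuousLinearMap ((Module.finBasis ℝ V).coord i))) ?_ ?_
  · exact Flat.sum hU h0 _ fun i _ => (hηf _).smul hU h0
      (hg'.contDiffOn_inverse.clm_apply contDiffOn_const)
  · intro p hp
    refine hg'.ext hp fun w => ?_
    have h1 : ∀ w, (g p + h p) (christoffel (fun p => g p + h p) p u v - christoffel g p u v) w
        = η w p := by
      intro w
      have h2 := hg'.apply_christoffel hp u v w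
      have h3 := hg.apply_christoffel hp u v w
      simp only [hsum] at h2
      simp only [map_sub, add_apply, sub_apply, hη] at h2 ⊢
      linarith
    have h4 : ∀ i, (g p + h p) ((g p + h p).inverse
        (LinearMap.toContinuousLinearMap ((Module.finBasis ℝ V).coord i))) w
        = (LinearMap.toContinuousLinearMap ((Module.finBasis ℝ V).coord i)) w := fun i => by
      rw [(hg'.inv p hp).self_apply_inverse]
    rw [h1, map_sum]
    simp only [map_smul, sum_apply, smul_apply, h4, smul_eq_mul]
    simp only [← h1]
    refine (IsLinearMap.eq_sum_coord (ContinuousLinearMap.toLinearMap _).isLinear w).trans ?_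
    exact Finset.sum_congr rfl fun i _ => mul_comm _ _

/-- The second-derivative part of the curvature is linear in the metric, so it contributes exactly
the linearized curvature of `h`. The error comes only from the terms quadratic in `Γ`, and vanishes
to one order more than is guaranteed for the linear part. -/
lemma flat_riemann_sub (hg : IsRegular g U) (hg' : IsRegular (fun p => g p + h p) U)
    (h0 : (0 : V) ∈ U) (hs : ContDiff ℝ ∞ h) (hh : ∀ y z, Flat U (k + 2) fun p => h p y z)
    (u v w z : V) :
    Flat U (k + 1) fun p => riemann (fun p => g p + h p) p u v w z - riemann g p u v w z
      - linearizedCurvature h u v w z p := by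
  have hU := hg.isOpen
  have hflat := hg.flat_christoffel_sub hg' h0 hs hh
  -- Telescoping: `h(Γ', Γ') + g(Γ' - Γ, Γ') + g(Γ, Γ' - Γ)`.
  have hquad : ∀ a b c d, Flat U (k + 1) fun p =>
      (g p + h p) (christoffel (fun p => g p + h p) p a b) (christoffel (fun p => g p + h p) p c d)
        - g p (christoffel g p a b) (christoffel g p c d) := by
    intro a b c d
    have hΓ := hg.contDiffOn_christoffel
    have hΓ' := hg'.contDiffOn_christoffel
    have h1 := flat_slot_left hU h0 (m := k + 1)
      (L := fun p y => h p y (christoffel (fun p => g p + h p) p c d))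
      (fun p _ => ⟨fun x y => by simp, fun r x => by simp⟩)
      (fun y => flat_slot_left hU h0 (L := fun p x => h p y x)
        (fun p _ => ⟨fun x y => by simp, fun r x => by simp⟩)
        (fun x => (hh y x).of_succ) (hΓ' c d)) (hΓ' a b)
    have h2 := flat_slot_right hU h0
      (L := fun p y => g p y (christoffel (fun p => g p + h p) p c d))
      (fun p _ => ⟨fun x y => by simp, fun r x => by simp⟩)
      (fun y => (hg.smooth.contDiffOn.clm_apply contDiffOn_const).clm_apply (hΓ' c d)) (hflat a b)
    have h3 := flat_slot_right hU h0
      (L := fun p y => g p (christoffel g p a b) y)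
      (fun p _ => ⟨fun x y => by simp, fun r x => by simp⟩)
      (fun y => (hg.smooth.contDiffOn.clm_apply (hΓ a b)).clm_apply contDiffOn_const) (hflat c d)
    refine ((h1.add hU h0 h2).add hU h0 h3).congr hU h0 fun p hp => ?_
    simp only [map_sub, add_apply, sub_apply]
    ring
  refine Flat.congr hU h0 ((hquad u w v z).sub hU h0 (hquad v w u z)) fun p hp => ?_
  have hD : ∀ a b c d, fderiv ℝ (fderiv ℝ fun p => g p + h p) p a b c d
      = fderiv ℝ (fderiv ℝ g) p a b c d
        + fderiv ℝ (fun q => fderiv ℝ (fun q' => h q' c d) q b) p a := by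
    intro a b c d
    have hs' : ContDiff ℝ ∞ (fderiv ℝ h) := hs.fderiv_right (by simp)
    have hs'' : DifferentiableAt ℝ (fun q => fderiv ℝ h q b c d) p :=
      ((((hs'.clm_apply contDiff_const).clm_apply contDiff_const).clm_apply
        contDiff_const).differentiable (by simp)) p
    have hg'' : DifferentiableAt ℝ (fun q => fderiv ℝ g q b c d) p :=
      ((((hg.smooth_fderiv.clm_apply contDiff_const).clm_apply contDiff_const).clm_apply
        contDiff_const).differentiable (by simp)) p
    rw [← hg'.fderiv_fderiv_apply, ← hg.fderiv_fderiv_apply]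
    simp only [← fderiv_apply_apply hs]
    have : (fun q => fderiv ℝ (fun p => g p + h p) q b c d)
        = fun q => fderiv ℝ g q b c d + fderiv ℝ h q b c d := by
      funext q
      rw [fderiv_fun_add (hg.differentiableAt q) (hs.differentiable (by simp) q)]
      rfl
    rw [this, fderiv_fun_add hg'' hs'']
    rfl
  rw [hg.riemann_eq_linearCurvature hp, hg'.riemann_eq_linearCurvature hp]
  simp only [linearizedCurvature, linearCurvature, hD]
  ring

/-- Each differentiation costs one order, whence `l + n = k`. The Christoffel terms of the covariant
derivative need not be expanded: at order `l` the two jets already differ only to order `k - l`,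
which is what the next error term allows. At the origin, up to order `k`, the jet changes exactly by
the directional derivatives of the linearized curvature. -/
lemma flat_jetField_sub (hg : IsRegular g U) (hg' : IsRegular (fun p => g p + h p) U)
    (h0 : (0 : V) ∈ U) (hs : ContDiff ℝ ∞ h) (hh : ∀ y z, Flat U (k + 2) fun p => h p y z)
    (l n : ℕ) (hn : l + n = k) (c : List V) (hc : c.length = l) (y₁ y₂ y₃ y₄ : V) :
    Flat U (n + 1) fun p => jetField (fun p => g p + h p) p c y₁ y₂ y₃ y₄
      - jetField g p c y₁ y₂ y₃ y₄ - iterDir (linearizedCurvature h y₁ y₂ y₃ y₄) c p := by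
  have hU := hg.isOpen
  induction l generalizing n c y₁ y₂ y₃ y₄ with
  | zero =>
    obtain rfl : n = k := by simpa using hn
    obtain rfl := List.length_eq_zero_iff.1 hc
    exact hg.flat_riemann_sub hg' h0 hs hh y₁ y₂ y₃ y₄
  | succ l ih =>
    match c, hc with
    | a :: c, hc =>
    rw [List.length_cons, Nat.add_right_cancel_iff] at hc
    have hlin : ∀ c : List V, c.length = l → ∀ y₁ y₂ y₃ y₄,
        Flat U (n + 1) (iterDir (linearizedCurvature h y₁ y₂ y₃ y₄) c) :=
      fun c hc y₁ y₂ y₃ y₄ => Flat.iterDir c ((flat_linearizedCurvature hU h0 hh y₁ y₂ y₃ y₄).mono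
        (by omega))
    have hE := ih (n + 1) (by omega)
    have hΓ := fun v => (hg.flat_christoffel_sub hg' h0 hs hh a v).mono
      (show n + 1 ≤ k + 1 by omega)
    have hact := flat_der_sub hU h0 (F := fun p => flatten (jetField g p))
      (F' := fun p => flatten (jetField (fun p => g p + h p) p))
      (A := fun p => christoffel g p a) (A' := fun p => christoffel (fun p => g p + h p) p a)
      (m := n + 1) (y₁ :: y₂ :: y₃ :: y₄ :: c)
      (fun p hp => hg.multiAt_jetField hp _) (fun p hp => hg'.multiAt_jetField hp _)
      (fun Q hQ => (hg'.jetField_regular c.length).2 Q (by simpa using hQ))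
      (hg.contDiffOn_christoffel a)
      (fun Q hQ => by
        match Q, hQ with
        | z₁ :: z₂ :: z₃ :: z₄ :: Q, hQ =>
          have hQ' : Q.length = l := by simpa [hc] using hQ
          refine ((hE Q hQ' z₁ z₂ z₃ z₄).of_succ.add hU h0 (hlin Q hQ' z₁ z₂ z₃ z₄)).congr hU h0
            fun p _ => ?_
          simp [flatten])
      hΓ
    refine (((hE c hc y₁ y₂ y₃ y₄).2.2 a).add hU h0 hact).congr hU h0 fun p hp => ?_
    have h1 := hg.differentiableAt_jetField hp c y₁ y₂ y₃ y₄
    have h2 := hg'.differentiableAt_jetField hp c y₁ y₂ y₃ y₄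
    have h3 := (hlin c hc y₁ y₂ y₃ y₄).contDiffOn.differentiableAt_of_isOpen hU hp
    rw [fderiv_fun_sub (h2.fun_sub h1) h3, fderiv_fun_sub h2 h1, jetField_cons, jetField_cons,
      der_flatten, der_flatten]
    simp only [iterDir, sub_apply]
    ring

end IsRegular

end

/-! ### Inverting the linearized curvature on homogeneous Bianchi fields. -/

section

variable {V : Type*} [NormedAddCommGroup V] [NormedSpace ℝ V]

/-! ### Algebra of curvature tensors -/

namespace IsAlgCurvature

variable {A : V → V → V → V → ℝ}

lemma skew_right (hA : IsAlgCurvature A) (x y z w : V) : A x y z w = -A x y w z := by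
  rw [hA.pair_symm, hA.skew, hA.pair_symm w z]

/-- This and the next two identities evaluate the patterns arising when two derivatives of `K_p(y,
p, p, z)` are inserted into the linearized curvature: the first two when one derivative falls on
`K`, the last when both fall on the explicit arguments `p`. -/
lemma sum_four_left (hA : IsAlgCurvature A) (u v p z : V) :
    A v u p z + A v p u z - A u v p z - A u p v z = -3 * A u v p z := by
  have h1 := hA.skew v u p z
  have h2 := hA.bianchi₁ u v p z
  have h3 := hA.skew u p v z
  linarith

lemma sum_four_right (hA : IsAlgCurvature A) (v p w z : V) :
    A v w p z + A v p w z - A v z p w - A v p z w = 3 * A v p w z := by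
  have h1 := hA.bianchi₁ w z p v
  have h2 := hA.skew_right v p w z
  have h3 : A v w p z = A z p w v := by
    rw [hA.skew v w, hA.pair_symm w v p z, hA.skew p z, neg_neg]
  have h4 : A v z p w = -A p w z v := by rw [hA.pair_symm v z, hA.skew_right p w]
  have h5 : A w z p v = -A v p w z := by rw [hA.pair_symm, hA.skew]
  linarith

lemma sum_eight (hA : IsAlgCurvature A) (u v w z : V) :
    (A v w u z + A v u w z) - (A v z u w + A v u z w) - (A u w v z + A u v w z)
      + (A u z v w + A u v z w) = -6 * A u v w z := by
  have h1 := hA.skew v u w z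
  have h2 := hA.skew v u z w
  have h3 := hA.skew_right u v z w
  have h4 := hA.bianchi₁ u v w z
  have h5 := hA.bianchi₁ u v z w
  have h6 := hA.skew u w v z
  have h7 := hA.skew u z v w
  linarith

end IsAlgCurvature

variable [FiniteDimensional ℝ V]

/-! ### The linearized metric of a field of curvature tensors -/

lemma fderiv_slot {L : V → V → ℝ} (hlin : ∀ p, IsLinearMap ℝ (L p))
    (hL : ∀ v, ContDiff ℝ ∞ fun p => L p v) (p a : V) :
    fderiv ℝ (fun q => L q q) p a = fderiv ℝ (fun q => L q p) p a + L p a := by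
  have h1 := hasDerivAt_slot (L := fun t v => L (p + t • a) v)
    (L' := fun v => fderiv ℝ (fun q => L q v) p a) (w := fun t => p + t • a)
    (Eventually.of_forall fun t => hlin _)
    (fun v => hasDerivAt_line a (((hL v).differentiable (by simp)) p).hasFDerivAt)
    (hasDerivAt_line a (hasFDerivAt_id p))
  have h2 : DifferentiableAt ℝ (fun q => L q q) p :=
    (contDiffOn_slot (U := univ) (fun p _ => hlin p) (fun v => (hL v).contDiffOn)
      contDiffOn_id).differentiableAt_of_isOpen isOpen_univ trivial
  rw [(hasDerivAt_line a h2.hasFDerivAt).unique h1]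
  simp

lemma contDiff_slot {L : V → V → ℝ} (hlin : ∀ p, IsLinearMap ℝ (L p))
    (hL : ∀ v, ContDiff ℝ ∞ fun p => L p v) : ContDiff ℝ ∞ fun q => L q q :=
  contDiffOn_univ.1 (contDiffOn_slot (fun p _ => hlin p) (fun v => (hL v).contDiffOn)
    contDiffOn_id)

lemma isLinearMap_fderiv {L : V → V → ℝ} (hlin : ∀ p, IsLinearMap ℝ (L p))
    (hL : ∀ v, ContDiff ℝ ∞ fun p => L p v) (p a : V) :
    IsLinearMap ℝ fun v => fderiv ℝ (fun q => L q v) p a := by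
  have hd := fun v => ((hL v).differentiable (by simp)) p
  constructor
  · intro x y
    simp only [fun q => (hlin q).map_add x y]
    rw [fderiv_fun_add (hd x) (hd y)]
    rfl
  · intro r x
    simp only [fun q => (hlin q).map_smul r x, smul_eq_mul]
    rw [fderiv_const_mul (hd x)]
    rfl

lemma _root_.ContDiff.fderiv_apply_const {f : V → ℝ} (hf : ContDiff ℝ ∞ f) (a : V) :
    ContDiff ℝ ∞ fun q => fderiv ℝ f q a :=
  (hf.fderiv_right (by simp)).clm_apply contDiff_const

/-- A smooth field of curvature tensors, homogeneous of degree `k`, which satisfies the second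
Bianchi identity of flat space. -/
structure IsBianchiField (k : ℕ) (K : V → V → V → V → V → ℝ) : Prop where
  curvature : ∀ p, IsAlgCurvature (K p)
  linear₂ : ∀ p u w z, IsLinearMap ℝ fun v => K p u v w z
  smooth : ∀ u v w z, ContDiff ℝ ∞ fun p => K p u v w z
  bianchi₂ : ∀ p x u v w z, fderiv ℝ (fun q => K q u v w z) p x
    + fderiv ℝ (fun q => K q v x w z) p u + fderiv ℝ (fun q => K q x u w z) p v = 0
  euler : ∀ p u v w z, fderiv ℝ (fun q => K q u v w z) p p = k * K p u v w z

lemma isAlgCurvature_fderiv {K : V → V → V → V → V → ℝ} (hK : ∀ p, IsAlgCurvature (K p))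
    (hs : ∀ u v w z, ContDiff ℝ ∞ fun p => K p u v w z) (p a : V) :
    IsAlgCurvature fun u v w z => fderiv ℝ (fun q => K q u v w z) p a := by
  have hd := fun u v w z => ((hs u v w z).differentiable (by simp)) p
  constructor
  · intro u v w z
    rw [show (fun q => K q u v w z) = fun q => -K q v u w z from funext fun q => (hK q).skew ..,
      fderiv_fun_neg]
    rfl
  · intro u v w z
    rw [show (fun q => K q u v w z) = fun q => K q w z u v from
      funext fun q => (hK q).pair_symm ..]
  · intro u v w z
    have h : (fun q => K q u v w z + K q v w u z + K q w u v z) = fun _ => 0 :=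
      funext fun q => (hK q).bianchi₁ ..
    have h2 := congrArg (fun f => fderiv ℝ f p a) h
    beta_reduce at h2
    rw [fderiv_fun_add ((hd _ _ _ _).fun_add (hd _ _ _ _)) (hd _ _ _ _),
      fderiv_fun_add (hd _ _ _ _) (hd _ _ _ _)] at h2
    simpa using h2

/-- The curvature symmetries exchange the second and third slots, up to sign and relabelling. -/
lemma isLinearMap_third {A : V → V → V → V → ℝ} (hA : IsAlgCurvature A)
    (h : ∀ u w z, IsLinearMap ℝ fun v => A u v w z) (u v z : V) :
    IsLinearMap ℝ fun w => A u v w z := by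
  have h2 : ∀ w, A u v w z = -A z w u v := fun w => by rw [hA.pair_symm, hA.skew]
  simp only [h2]
  exact ⟨fun x y => by rw [(h z u v).map_add]; ring,
    fun r x => by rw [(h z u v).map_smul, smul_eq_mul, smul_eq_mul]; ring⟩

lemma fderiv_slot_slot {K : V → V → V → V → V → ℝ} (hA : ∀ p, IsAlgCurvature (K p))
    (hl : ∀ p u w z, IsLinearMap ℝ fun v => K p u v w z)
    (hs : ∀ u v w z, ContDiff ℝ ∞ fun p => K p u v w z) (p y z b : V) :
    fderiv ℝ (fun q => K q y q q z) p b
      = fderiv ℝ (fun q => K q y p p z) p b + K p y b p z + K p y p b z := by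
  have hl₃ := fun p => isLinearMap_third (hA p) (hl p)
  rw [fderiv_slot (L := fun q v => K q y v q z) (fun q => hl q y q z)
    (fun v => contDiff_slot (L := fun q w => K q y v w z) (fun q => hl₃ q y v z) fun w =>
      hs y v w z), fderiv_slot (L := fun q w => K q y p w z) (fun q => hl₃ q y p z) fun w =>
      hs y p w z]
  ring

lemma contDiff_slot_slot {K : V → V → V → V → V → ℝ} (hA : ∀ p, IsAlgCurvature (K p))
    (hl : ∀ p u w z, IsLinearMap ℝ fun v => K p u v w z)
    (hs : ∀ u v w z, ContDiff ℝ ∞ fun p => K p u v w z) (y z : V) :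
    ContDiff ℝ ∞ fun q => K q y q q z :=
  contDiff_slot (L := fun q v => K q y v q z) (fun q => hl q y q z)
    (fun v => contDiff_slot (L := fun q w => K q y v w z)
      (fun q => isLinearMap_third (hA q) (hl q) y v z) fun w => hs y v w z)

namespace IsBianchiField

variable {k : ℕ} {K : V → V → V → V → V → ℝ}

/-- Leibniz expansion: both derivatives on `K`, one on `K` and one on an explicit argument, or both
on the explicit arguments. -/
lemma fderiv_fderiv_quadratic (hK : IsBianchiField k K) (p y z a b : V) :
    fderiv ℝ (fun q => fderiv ℝ (fun r => K r y r r z) q b) p a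
      = fderiv ℝ (fun q => fderiv ℝ (fun r => K r y p p z) q b) p a
        + fderiv ℝ (fun q => K q y a p z) p b + fderiv ℝ (fun q => K q y p a z) p b
        + fderiv ℝ (fun q => K q y b p z) p a + fderiv ℝ (fun q => K q y p b z) p a
        + (K p y b a z + K p y a b z) := by
  have hl₃ := fun p => isLinearMap_third (hK.curvature p) (hK.linear₂ p)
  have hs' := fun u v w z => (hK.smooth u v w z).fderiv_apply_const b
  have hA' := fun q => isAlgCurvature_fderiv hK.curvature hK.smooth q b
  have hl' : ∀ q u w z, IsLinearMap ℝ fun v => fderiv ℝ (fun r => K r u v w z) q b :=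
    fun q u w z => isLinearMap_fderiv (L := fun r v => K r u v w z)
      (fun r => hK.linear₂ r u w z) (fun v => hK.smooth u v w z) q b
  simp only [fun q => fderiv_slot_slot hK.curvature hK.linear₂ hK.smooth q y z b]
  have d1 := (contDiff_slot_slot hA' hl' hs' y z).differentiable (by simp) p
  have d2 := (contDiff_slot (L := fun q v => K q y b v z) (fun q => hl₃ q y b z)
    (fun v => hK.smooth y b v z)).differentiable (by simp) p
  have d3 := (contDiff_slot (L := fun q v => K q y v b z) (fun q => hK.linear₂ q y b z)
    (fun v => hK.smooth y v b z)).differentiable (by simp) p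
  rw [fderiv_fun_add (d1.fun_add d2) d3, fderiv_fun_add d1 d2, add_apply, add_apply,
    fderiv_slot_slot hA' hl' hs' p y z a,
    fderiv_slot (L := fun q v => K q y b v z) (fun q => hl₃ q y b z) (fun v => hK.smooth y b v z),
    fderiv_slot (L := fun q v => K q y v b z) (fun q => hK.linear₂ q y b z)
      (fun v => hK.smooth y v b z)]
  ring

lemma bianchi_fderiv (hK : IsBianchiField k K) (p b x u v w z : V) :
    fderiv ℝ (fun q => fderiv ℝ (fun r => K r u v w z) q x) p b
      + fderiv ℝ (fun q => fderiv ℝ (fun r => K r v x w z) q u) p b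
      + fderiv ℝ (fun q => fderiv ℝ (fun r => K r x u w z) q v) p b = 0 := by
  have hd := fun u v w z a => ((hK.smooth u v w z).fderiv_apply_const a).differentiable (by simp) p
  have h := congrArg (fun f => fderiv ℝ f p b) (funext fun q => hK.bianchi₂ q x u v w z)
  beta_reduce at h
  rw [fderiv_fun_add ((hd _ _ _ _ _).fun_add (hd _ _ _ _ _)) (hd _ _ _ _ _),
    fderiv_fun_add (hd _ _ _ _ _) (hd _ _ _ _ _)] at h
  simpa using h

/-- Euler's relation for the first derivatives, which are homogeneous of degree `k - 1`. -/
lemma euler_fderiv (hK : IsBianchiField k K) (p b u v w z : V) :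
    fderiv ℝ (fun q => fderiv ℝ (fun r => K r u v w z) q p) p b
      = (k - 1) * fderiv ℝ (fun r => K r u v w z) p b := by
  have h := congrArg (fun f => fderiv ℝ f p b) (funext fun q => hK.euler q u v w z)
  beta_reduce at h
  rw [fderiv_slot (L := fun q a => fderiv ℝ (fun r => K r u v w z) q a)
    (fun q => (fderiv ℝ (fun r => K r u v w z) q).toLinearMap.isLinear)
    (fun a => (hK.smooth u v w z).fderiv_apply_const a),
    fderiv_const_mul ((hK.smooth u v w z).differentiable (by simp) p)] at h
  simp only [smul_apply, smul_eq_mul] at h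
  linarith

/-- The linearized curvature of the metric perturbation `K_ξ(y, ξ, ξ, z)` is a multiple of `K`. -/
lemma linearizedCurvature_eq (hK : IsBianchiField k K) {h : V → V →L[ℝ] V →L[ℝ] ℝ}
    (hh : ∀ p y z, h p y z = -2 / ((k + 2) * (k + 3)) * K p y p p z) (u v w z p : V) :
    linearizedCurvature h u v w z p = K p u v w z := by
  have hd : ∀ y z, ContDiff ℝ ∞ fun q => K q y q q z :=
    contDiff_slot_slot hK.curvature hK.linear₂ hK.smooth
  have hswap : ∀ y z a b, fderiv ℝ (fun q => fderiv ℝ (fun r => K r y p p z) q b) p a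
      = fderiv ℝ (fun q => fderiv ℝ (fun r => K r y p p z) q a) p b := fun y z a b =>
    fderiv_fderiv_swap isOpen_univ (hK.smooth y p p z).contDiffOn trivial a b
  have hH : ∀ y z a b, fderiv ℝ (fun q => fderiv ℝ (fun r => h r y z) q b) p a
      = -2 / ((k + 2) * (k + 3)) * fderiv ℝ (fun q => fderiv ℝ (fun r => K r y r r z) q b) p a := by
    intro y z a b
    simp only [hh]
    have h1 : ∀ q, fderiv ℝ (fun r => -2 / ((k + 2) * (k + 3)) * K r y r r z) q b
        = -2 / ((k + 2) * (k + 3)) * fderiv ℝ (fun r => K r y r r z) q b := fun q => by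
      rw [fderiv_const_mul ((hd y z).differentiable (by simp) q)]
      rfl
    simp only [h1]
    rw [fderiv_const_mul (((hd y z).fderiv_apply_const b).differentiable (by simp) p)]
    rfl
  have hA := fun a => isAlgCurvature_fderiv hK.curvature hK.smooth p a
  have hA2 := fun a b => isAlgCurvature_fderiv
    (fun q => isAlgCurvature_fderiv hK.curvature hK.smooth q b)
    (fun u v w z => (hK.smooth u v w z).fderiv_apply_const b) p a
  -- second derivatives
  have e1 := hK.bianchi_fderiv p w u v p p z
  have e2 := hK.bianchi_fderiv p z u v p p w
  have e3 := (hA2 w v).skew u p p z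
  have e4 := (hA2 z v).skew u p p w
  have e5 := hK.euler_fderiv p w u v p z
  have e6 := hK.euler_fderiv p z u v p w
  -- first derivatives
  have f1 := (hA w).sum_four_left u v p z
  have f2 := (hA z).sum_four_left u v p w
  have f3 := (hA u).sum_four_right v p w z
  have f4 := (hA v).sum_four_right u p w z
  have f5 := hK.bianchi₂ p u v p w z
  have f6 := (hA v).skew u p w z
  have f7 := hK.euler p u v w z
  have f8 := hK.bianchi₂ p p z w u v
  have f9 := (hA w).pair_symm u v p z
  have f10 := (hA z).pair_symm u v p w
  have f11 := (hA z).skew p w u v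
  have f12 := hK.euler p z w u v
  have f13 : K p z w u v = -K p u v w z := by
    rw [(hK.curvature p).skew, (hK.curvature p).pair_symm w z]
  rw [f13] at f12
  have g1 := (hK.curvature p).sum_eight u v w z
  -- The second Bianchi identity, applied across the pair symmetry, turns this difference into the
  -- radial derivative, which Euler's relation evaluates.
  have g2 : fderiv ℝ (fun q => K q u v p z) p w - fderiv ℝ (fun q => K q u v p w) p z
      = k * K p u v w z := by linarith
  have g3 := congrArg (fun x => ((k : ℝ) - 1) * x) g2
  beta_reduce at g3
  -- Origin of the constant: terms with two, one and no derivatives on `K` contribute `-k(k - 1)`,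
  -- `-6k` and `-6` times `K`, in total `-(k + 2)(k + 3)`. The `2` offsets the factor one half in
  -- `linearCurvature`.
  have key : ∀ Q₁ Q₂ Q₃ Q₄ : ℝ, Q₁ - Q₂ - Q₃ + Q₄ = -((k + 2) * (k + 3)) * K p u v w z →
      (-2 / ((k + 2) * (k + 3)) * Q₁ - -2 / ((k + 2) * (k + 3)) * Q₂
        - -2 / ((k + 2) * (k + 3)) * Q₃ + -2 / ((k + 2) * (k + 3)) * Q₄) / 2
        = K p u v w z := by
    intro Q₁ Q₂ Q₃ Q₄ hQ
    rw [← mul_sub, ← mul_sub, ← mul_add, hQ]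
    field_simp
  simp only [linearizedCurvature, linearCurvature, hH]
  apply key
  simp only [hK.fderiv_fderiv_quadratic, hswap _ _ u, hswap _ _ v]
  linarith

end IsBianchiField

end

/-! ### From a symmetric jet to a polynomial perturbation of the metric. -/

section

variable {V : Type*} [NormedAddCommGroup V] [NormedSpace ℝ V] [FiniteDimensional ℝ V]

/-! ### The polynomial of a symmetric algebraic jet -/

/-- A multilinear list tensor whose component of order `k` is symmetric in the derivative slots
and satisfies the algebraic identities of a covariant derivative of a curvature tensor. -/
structure IsSymmetricJet (k : ℕ) (D : ListTensor V) : Prop where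
  multi : ∀ n, MultiAt n (flatten D)
  curvature : ∀ c : List V, c.length = k → IsAlgCurvature (D c)
  bianchi₂ : ∀ c : List V, c.length + 1 = k → ∀ x₁ x₂ x₃ y₁ y₂,
    D (c ++ [x₁]) x₂ x₃ y₁ y₂ + D (c ++ [x₂]) x₃ x₁ y₁ y₂ + D (c ++ [x₃]) x₁ x₂ y₁ y₂ = 0
  swap : ∀ (a : List V) (x y : V) (c : List V), a.length + c.length + 2 = k →
    D (a ++ x :: y :: c) = D (a ++ y :: x :: c)

namespace IsSymmetricJet

variable {k : ℕ} {D : ListTensor V}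

lemma perm (hD : IsSymmetricJet k D) {c c' : List V} (h : c.Perm c') (hc : c.length = k) :
    D c = D c' := by
  have key : ∀ pre : List V, pre.length + c.length = k → D (pre ++ c) = D (pre ++ c') := by
    clear hc
    induction h with
    | nil => exact fun _ _ => rfl
    | cons x _ ih =>
      intro pre hpre
      simpa using ih (pre ++ [x]) (by simp at hpre ⊢; omega)
    | swap x y l => exact fun pre hpre => hD.swap pre y x l (by simp at hpre; omega)
    | trans h₁ _ ih₁ ih₂ =>
      exact fun pre hpre => (ih₁ pre hpre).trans (ih₂ pre (h₁.length_eq ▸ hpre))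
  simpa using key [] (by simpa using hc)

lemma isLinearMap (hD : IsSymmetricJet k D) (c Q : List V) (y₁ y₂ y₃ y₄ : V) :
    IsLinearMap ℝ fun v => D (c ++ v :: Q) y₁ y₂ y₃ y₄ :=
  ((((((multiAt_flatten_append hD.multi c (Q.length + 1 + 4)).2 y₁).2 y₂).2 y₃).2 y₄).1 Q rfl)

lemma contDiff_replicate (hD : IsSymmetricJet k D) (m : ℕ) (c : List V) (y₁ y₂ y₃ y₄ : V) :
    ContDiff ℝ ∞ fun p => D (c ++ List.replicate m p) y₁ y₂ y₃ y₄ := by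
  induction m generalizing c with
  | zero => simpa using contDiff_const
  | succ m ih =>
    exact contDiff_slot (L := fun p v => D (c ++ v :: List.replicate m p) y₁ y₂ y₃ y₄)
      (fun p => hD.isLinearMap c _ y₁ y₂ y₃ y₄) fun v => by simpa using ih (c ++ [v])

/-- By symmetry all `m + 1` slots filled with the variable give the same contribution. -/
lemma fderiv_replicate (hD : IsSymmetricJet k D) (m : ℕ) (c : List V) (hc : c.length + m + 1 = k)
    (y₁ y₂ y₃ y₄ p a : V) :
    fderiv ℝ (fun q => D (c ++ List.replicate (m + 1) q) y₁ y₂ y₃ y₄) p a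
      = (m + 1) * D (c ++ a :: List.replicate m p) y₁ y₂ y₃ y₄ := by
  induction m generalizing c with
  | zero =>
    have h := fderiv_slot (L := fun _ v => D (c ++ [v]) y₁ y₂ y₃ y₄)
      (fun p => hD.isLinearMap c [] y₁ y₂ y₃ y₄) (fun v => contDiff_const) p a
    simpa using h
  | succ m ih =>
    have h := fderiv_slot (L := fun q v => D (c ++ v :: List.replicate (m + 1) q) y₁ y₂ y₃ y₄)
      (fun p => hD.isLinearMap c _ y₁ y₂ y₃ y₄) (fun v => by
        simpa using hD.contDiff_replicate (m + 1) (c ++ [v]) y₁ y₂ y₃ y₄) p a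
    have h1 := ih (c ++ [p]) (by simp; omega)
    have h2 : D ((c ++ [p]) ++ a :: List.replicate m p) = D (c ++ a :: List.replicate (m + 1) p) := by
      refine hD.perm ?_ (by simp; omega)
      rw [List.append_assoc]
      exact List.Perm.append_left c (List.Perm.swap a p (List.replicate m p))
    rw [h2] at h1
    simp only [List.append_assoc, List.singleton_append] at h1
    simp only [List.replicate_succ (n := m + 1)]
    rw [h, h1]
    push_cast
    ring

/-- The homogeneous polynomial with polarization `D (c, …)`. -/
def poly (D : ListTensor V) (c : List V) (m : ℕ) (y₁ y₂ y₃ y₄ p : V) : ℝ :=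
  (m.factorial : ℝ)⁻¹ * D (c ++ List.replicate m p) y₁ y₂ y₃ y₄

lemma poly_zero (D : ListTensor V) (c : List V) (y₁ y₂ y₃ y₄ : V) :
    poly D c 0 y₁ y₂ y₃ y₄ = fun _ => D c y₁ y₂ y₃ y₄ := by
  funext p
  simp [poly]

lemma contDiff_poly (hD : IsSymmetricJet k D) (m : ℕ) (c : List V) (y₁ y₂ y₃ y₄ : V) :
    ContDiff ℝ ∞ (poly D c m y₁ y₂ y₃ y₄) :=
  contDiff_const.mul (hD.contDiff_replicate m c y₁ y₂ y₃ y₄)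

/-- The inverse factorial is chosen so that differentiating just freezes one more slot, without a
numerical factor. -/
lemma fderiv_poly (hD : IsSymmetricJet k D) (m : ℕ) (c : List V) (hc : c.length + m + 1 = k)
    (y₁ y₂ y₃ y₄ p a : V) :
    fderiv ℝ (poly D c (m + 1) y₁ y₂ y₃ y₄) p a = poly D (c ++ [a]) m y₁ y₂ y₃ y₄ p := by
  have h := fderiv_const_mul ((hD.contDiff_replicate (m + 1) c y₁ y₂ y₃ y₄).differentiable
    (by simp) p) ((m + 1).factorial : ℝ)⁻¹
  change fderiv ℝ (fun q => _) p a = _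
  simp only [poly]
  rw [h, smul_apply, hD.fderiv_replicate m c hc, Nat.factorial_succ, smul_eq_mul]
  have h1 : (m.factorial : ℝ) ≠ 0 := by exact_mod_cast m.factorial_ne_zero
  have h2 : (m : ℝ) + 1 ≠ 0 := by positivity
  simp only [List.append_assoc, List.singleton_append]
  push_cast
  field_simp

lemma flat_poly (hD : IsSymmetricJet k D) (m : ℕ) (c : List V) (hc : c.length + m = k)
    (U : Set V) (y₁ y₂ y₃ y₄ : V) : Flat U m (poly D c m y₁ y₂ y₃ y₄) := by
  induction m generalizing c with
  | zero => exact (hD.contDiff_poly 0 c y₁ y₂ y₃ y₄).contDiffOn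
  | succ m ih =>
    refine ⟨(hD.contDiff_poly _ c y₁ y₂ y₃ y₄).contDiffOn, ?_, fun a => ?_⟩
    · rw [poly, List.replicate_succ, (hD.isLinearMap c _ y₁ y₂ y₃ y₄).map_zero, mul_zero]
    · rw [show (fun q => _) = _ from funext fun q => hD.fderiv_poly m c (by omega) y₁ y₂ y₃ y₄ q a]
      exact ih (c ++ [a]) (by simp; omega)

/-- The head of the list is the outermost derivative, so directions are frozen from the end of the
list; hence the reversal, later undone by symmetry. -/
lemma iterDir_poly (hD : IsSymmetricJet k D) (m : ℕ) (c as : List V)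
    (hc : c.length + as.length + m = k) (y₁ y₂ y₃ y₄ : V) :
    iterDir (poly D c (m + as.length) y₁ y₂ y₃ y₄) as
      = poly D (c ++ as.reverse) m y₁ y₂ y₃ y₄ := by
  induction as generalizing m with
  | nil => simp [iterDir]
  | cons a as ih =>
    funext p
    simp only [List.length_cons] at hc
    have h := ih (m + 1) (by omega)
    rw [iterDir, List.length_cons, show m + (as.length + 1) = m + 1 + as.length by ring, h]
    beta_reduce
    rw [hD.fderiv_poly m _ (by simp; omega)]
    simp

lemma isBianchiField (hD : IsSymmetricJet k D) :
    IsBianchiField k fun p u v w z => poly D [] k u v w z p where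
  curvature p := by
    have h := hD.curvature (List.replicate k p) (by simp)
    constructor
    · intro u v w z
      simp only [poly, List.nil_append]
      rw [h.skew]
      ring
    · intro u v w z
      simp only [poly, List.nil_append]
      rw [h.pair_symm]
    · intro u v w z
      simp only [poly, List.nil_append]
      rw [← mul_add, ← mul_add, h.bianchi₁, mul_zero]
  linear₂ p u w z := by
    have h := (((hD.multi (k + 4)).2 u).1 (w :: z :: List.replicate k p) (by simp))
    exact ⟨fun x y => by
        simp only [poly, List.nil_append]; rw [← mul_add]; exact congrArg _ (h.map_add x y),
      fun r x => by
        simp only [poly, List.nil_append]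
        rw [smul_eq_mul, mul_left_comm]; exact congrArg _ (h.map_smul r x)⟩
  smooth u v w z := hD.contDiff_poly k [] u v w z
  bianchi₂ p x u v w z := by
    change fderiv ℝ (poly D [] k u v w z) p x + fderiv ℝ (poly D [] k v x w z) p u
      + fderiv ℝ (poly D [] k x u w z) p v = 0
    cases k with
    | zero => simp [poly_zero]
    | succ k =>
      rw [hD.fderiv_poly k [] (by simp), hD.fderiv_poly k [] (by simp),
        hD.fderiv_poly k [] (by simp)]
      -- Differentiation puts `x` in the first derivative slot, while the Bianchi identity of `D`
      -- concerns the last one; symmetry moves it there.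
      have h : ∀ x, D ([] ++ [x] ++ List.replicate k p) = D (List.replicate k p ++ [x]) := fun x =>
        hD.perm (by simpa using (List.perm_append_singleton x (List.replicate k p)).symm)
          (by simp)
      simp only [poly, h]
      rw [← mul_add, ← mul_add, hD.bianchi₂ _ (by simp), mul_zero]
  euler p u v w z := by
    change fderiv ℝ (poly D [] k u v w z) p p = k * poly D [] k u v w z p
    cases k with
    | zero => simp [poly_zero]
    | succ k =>
      rw [hD.fderiv_poly k [] (by simp)]
      have h1 : (k.factorial : ℝ) ≠ 0 := by exact_mod_cast k.factorial_ne_zero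
      have h2 : (k : ℝ) + 1 ≠ 0 := by positivity
      simp only [poly, Nat.factorial_succ, List.nil_append, List.replicate_succ,
        List.singleton_append]
      push_cast
      field_simp

end IsSymmetricJet

/-! ### The perturbation of the metric -/

lemma Flat.clm_mul {U : Set V} (hU : IsOpen U) (h0 : (0 : V) ∈ U) {m : ℕ} {f : V → ℝ}
    (l : V →L[ℝ] ℝ) (hf : Flat U m f) : Flat U (m + 1) fun p => f p * l p := by
  have hd : ∀ (f : V → ℝ), ContDiffOn ℝ ∞ f U → ∀ a, EqOn (fun q => fderiv ℝ (fun p => f p * l p) q a)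
      (fun q => fderiv ℝ f q a * l q + l a * f q) U := fun f hf a q hq => by
    beta_reduce
    rw [fderiv_fun_mul (hf.differentiableAt_of_isOpen hU hq) l.differentiableAt]
    simp
    ring
  induction m generalizing f with
  | zero =>
    refine ⟨hf.contDiffOn.mul l.contDiff.contDiffOn, by simp, fun a => ?_⟩
    exact (hf.contDiffOn.mul l.contDiff.contDiffOn).fderiv_apply_of_isOpen hU a
  | succ m ih =>
    refine ⟨hf.contDiffOn.mul l.contDiff.contDiffOn, by simp, fun a => ?_⟩
    exact ((ih (hf.2.2 a)).add hU h0 (hf.const_mul hU h0 (l a))).congr hU h0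
      (hd f hf.contDiffOn a)

/-- Filling a slot with the base point multiplies by its linear coordinates, and each such product
raises the order of vanishing by one. -/
lemma flat_slot_self {U : Set V} (hU : IsOpen U) (h0 : (0 : V) ∈ U) {m : ℕ} {L : V → V → ℝ}
    (hlin : ∀ p ∈ U, IsLinearMap ℝ (L p)) (hL : ∀ v, Flat U m fun p => L p v) :
    Flat U (m + 1) fun p => L p p := by
  refine Flat.congr hU h0 (f := fun p => ∑ i, L p (Module.finBasis ℝ V i) *
      (LinearMap.toContinuousLinearMap ((Module.finBasis ℝ V).coord i)) p) ?_ fun p hp => ?_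
  · exact Flat.sum hU h0 _ fun i _ => (hL _).clm_mul hU h0 _
  · simp only [mul_comm (L p _)]
    exact IsLinearMap.eq_sum_coord (hlin p hp) p

/-- A bilinear function as a continuous bilinear map. -/
def bilinOf (f : V → V → ℝ) (h₁ : ∀ z, IsLinearMap ℝ fun y => f y z)
    (h₂ : ∀ y, IsLinearMap ℝ (f y)) : V →L[ℝ] V →L[ℝ] ℝ :=
  LinearMap.toContinuousLinearMap (LinearMap.toContinuousLinearMap.toLinearMap ∘ₗ
    LinearMap.mk₂ ℝ f (fun x y z => (h₁ z).map_add x y) (fun r x z => (h₁ z).map_smul r x)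
      (fun y => (h₂ y).map_add) (fun r y => (h₂ y).map_smul r))

@[simp] lemma bilinOf_apply (f : V → V → ℝ) (h₁ : ∀ z, IsLinearMap ℝ fun y => f y z)
    (h₂ : ∀ y, IsLinearMap ℝ (f y)) (y z : V) : bilinOf f h₁ h₂ y z = f y z := rfl

/-- A symmetric algebraic jet is the leading part of the curvature of a perturbation in normal
coordinates. -/
lemma IsSymmetricJet.exists_perturbation {k : ℕ} {D : ListTensor V} (hD : IsSymmetricJet k D) :
    ∃ h : V → V →L[ℝ] V →L[ℝ] ℝ, ContDiff ℝ ∞ h ∧ (∀ p y z, h p y z = h p z y) ∧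
      (∀ p z, h p p z = 0) ∧
      (∀ U, IsOpen U → (0 : V) ∈ U → ∀ y z, Flat U (k + 2) fun p => h p y z) ∧
      ∀ c : List V, c.length = k → ∀ y₁ y₂ y₃ y₄,
        iterDir (linearizedCurvature h y₁ y₂ y₃ y₄) c 0 = D c y₁ y₂ y₃ y₄ := by
  have hK := hD.isBianchiField
  set K : V → V → V → V → V → ℝ := fun p u v w z => IsSymmetricJet.poly D [] k u v w z p with hKdef
  have hl₃ := fun p => isLinearMap_third (hK.curvature p) (hK.linear₂ p)
  have hsymm : ∀ p y z, K p y p p z = K p z p p y := fun p y z => by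
    rw [(hK.curvature p).pair_symm, (hK.curvature p).skew, (hK.curvature p).skew_right, neg_neg]
  have hlin : ∀ p y, IsLinearMap ℝ fun z => -2 / ((k + 2) * (k + 3)) * K p y p p z := by
    intro p y
    have h1 : ∀ z, K p y p p z = K p p z y p := fun z => (hK.curvature p).pair_symm ..
    simp only [h1]
    have h := hK.linear₂ p p y p
    constructor
    · intro x z
      rw [h.map_add]
      ring
    · intro r x
      rw [h.map_smul, smul_eq_mul, smul_eq_mul]
      ring
  set h : V → V →L[ℝ] V →L[ℝ] ℝ := fun p => bilinOf
    (fun y z => -2 / ((k + 2) * (k + 3)) * K p y p p z)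
    (fun z => by simp only [fun y => hsymm p y z]; exact hlin p z) (hlin p) with hdef
  have hh : ∀ p y z, h p y z = -2 / ((k + 2) * (k + 3)) * K p y p p z := fun p y z => rfl
  refine ⟨h, ?_, fun p y z => by rw [hh, hh, hsymm], fun p z => ?_, fun U hU h0 y z => ?_,
    fun c hc y₁ y₂ y₃ y₄ => ?_⟩
  · refine contDiff_clm_apply_iff.2 fun y => contDiff_clm_apply_iff.2 fun z => ?_
    exact contDiff_const.mul (contDiff_slot_slot hK.curvature hK.linear₂ hK.smooth y z)
  -- Skew-symmetry in the first pair gives `h_p(p, ·) = 0`, which preserves the gauge condition of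
  -- normal coordinates.
  · have := (hK.curvature p).skew p p p z
    rw [hh, show K p p p p z = 0 by linarith, mul_zero]
  · simp only [hh]
    refine Flat.const_mul hU h0 _ ?_
    -- `K` vanishes to order `k`, and each of the two slots filled with `p` adds one.
    exact flat_slot_self hU h0 (L := fun p v => K p y v p z) (fun p _ => hK.linear₂ p y p z)
      fun v => flat_slot_self hU h0 (L := fun p w => K p y v w z) (fun p _ => hl₃ p y v z)
        fun w => hD.flat_poly k [] (by simp) U y v w z
  · rw [show linearizedCurvature h y₁ y₂ y₃ y₄ = IsSymmetricJet.poly D [] (0 + c.length) y₁ y₂ y₃ y₄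
      from funext fun p => by rw [hK.linearizedCurvature_eq hh, zero_add, hc],
      hD.iterDir_poly 0 [] c (by simpa using hc)]
    simp only [IsSymmetricJet.poly, Nat.factorial_zero, List.nil_append, List.replicate_zero,
      List.append_nil]
    rw [hD.perm (List.reverse_perm c) (by simpa using hc)]
    simp

end

/-! ### Normal coordinates and the order-by-order realization. -/

section

variable {V : Type*} [NormedAddCommGroup V] [NormedSpace ℝ V] [FiniteDimensional ℝ V]

/-! ### Multilinearity of algebraic jets -/

lemma TensorSeq.eval_eq (J : TensorSeq V) {n : ℕ} (L : List V) (hL : L.length = n) :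
    J.eval L = J n fun i => L.get (i.cast hL.symm) := by
  subst hL
  rfl

lemma TensorSeq.isLinearMap_eval (J : TensorSeq V) (l₁ l₂ : List V) (y₁ y₂ y₃ y₄ : V) :
    IsLinearMap ℝ fun v => J.eval (l₁ ++ v :: l₂) y₁ y₂ y₃ y₄ := by
  have hn : ∀ v : V, (l₁ ++ v :: l₂).length = l₁.length + l₂.length + 1 := fun v => by
    simp; ring
  have h : ∀ v, J.eval (l₁ ++ v :: l₂) = J (l₁.length + l₂.length + 1)
      (Function.update (fun i => (l₁ ++ (0 : V) :: l₂).get (i.cast (hn 0).symm))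
        ⟨l₁.length, by omega⟩ v) := by
    intro v
    rw [J.eval_eq _ (hn v)]
    congr 1
    funext i
    rcases eq_or_ne i ⟨l₁.length, by omega⟩ with rfl | hi
    · simp
    · have hi' : i.val ≠ l₁.length := fun h => hi (Fin.ext h)
      rw [Function.update_of_ne hi]
      simp only [List.get_eq_getElem, Fin.val_cast, List.getElem_append, List.getElem_cons]
      split_ifs with h1 h2
      · rfl
      · omega
      · rfl
  simp only [h]
  exact ⟨fun x y => by rw [MultilinearMap.map_update_add]; simp,
    fun r x => by rw [MultilinearMap.map_update_smul]; simp⟩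

lemma TensorSeq.multiAt (J : TensorSeq V) (n : ℕ) : MultiAt n (flatten J.toListTensor) := by
  rcases lt_or_ge n 4 with h | h
  · exact multiAt_flatten_of_lt _ h
  obtain ⟨m, rfl⟩ := Nat.exists_eq_add_of_le' h
  have key : ∀ (m : ℕ) (pre : List V) (y₁ y₂ y₃ y₄ : V),
      MultiAt m fun Q => J.eval (pre ++ Q) y₁ y₂ y₃ y₄ := by
    intro m
    induction m with
    | zero => exact fun _ _ _ _ _ => trivial
    | succ m ih =>
      exact fun pre y₁ y₂ y₃ y₄ => ⟨fun c _ => J.isLinearMap_eval pre c y₁ y₂ y₃ y₄,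
        fun b => by simpa using ih (pre ++ [b]) y₁ y₂ y₃ y₄⟩
  refine ⟨fun c hc => ?_, fun y₁ => ⟨fun c hc => ?_, fun y₂ => ⟨fun c hc => ?_, fun y₃ =>
    ⟨fun c hc => ?_, fun y₄ => ?_⟩⟩⟩⟩
  · match c, hc with
    | y₂ :: y₃ :: y₄ :: c, _ =>
      exact ⟨fun x y => by simp [flatten, toListTensor], fun r x => by simp [flatten, toListTensor]⟩
  · match c, hc with
    | y₃ :: y₄ :: c, _ =>
      exact ⟨fun x y => by simp [flatten, toListTensor], fun r x => by simp [flatten, toListTensor]⟩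
  · match c, hc with
    | y₄ :: c, _ =>
      exact ⟨fun x y => by simp [flatten, toListTensor], fun r x => by simp [flatten, toListTensor]⟩
  · exact ⟨fun x y => by simp [flatten, toListTensor], fun r x => by simp [flatten, toListTensor]⟩
  · exact key m [] y₁ y₂ y₃ y₄

/-! ### Normal coordinates -/

/-- Differentiating `g_q(q, w) = g₀(q, w)` in direction `v` gives `Dg_p(v)(p, w) = g₀(v, w) - g_p(v,
w)`. This vanishes when `v` or `w` equals `p`, which covers all terms of Koszul's formula for
`Γ_p(p, p)`. -/
lemma IsRegular.christoffel_self {g₀ : V →L[ℝ] V →L[ℝ] ℝ} (hg₀ : IsScalarProduct g₀)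
    {g : V → V →L[ℝ] V →L[ℝ] ℝ} {U : Set V}
    (hg : IsRegular g U) (hnorm : ∀ p w, g p p w = g₀ p w) {p : V} (hp : p ∈ U) :
    christoffel g p p p = 0 := by
  have h1 : ∀ v w, fderiv ℝ g p v p w + g p v w = g₀ v w := by
    intro v w
    have h2 := ((hg.differentiableAt p).hasFDerivAt.clm_apply (hasFDerivAt_id p)).clm_apply
      (hasFDerivAt_const w p)
    have h3 := h2.unique ((((hasFDerivAt_const g₀ p).clm_apply (hasFDerivAt_id p)).clm_apply
      (hasFDerivAt_const w p)).congr_of_eventuallyEq (Eventually.of_forall fun q => hnorm q w))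
    have h4 := congrArg (fun f : V →L[ℝ] ℝ => f v) h3
    simp at h4
    linarith
  have h2 : ∀ w, fderiv ℝ g p p p w = 0 := fun w => by linarith [h1 p w, hnorm p w]
  have h4 : ∀ w, fderiv ℝ g p w p p = 0 := fun w => by
    linarith [h1 w p, hnorm p w, hg₀.symm w p, hg.symm p p w]
  refine hg.ext hp fun w => ?_
  rw [hg.apply_christoffel hp, h2, h4]
  simp

lemma IsRegular.isNormalOn {g₀ : V →L[ℝ] V →L[ℝ] ℝ} (hg₀ : IsScalarProduct g₀)
    {g : V → V →L[ℝ] V →L[ℝ] ℝ} {U : Set V} (hg : IsRegular g U) (hU : StarConvex ℝ 0 U) (hnorm : ∀ p w, g p p w = g₀ p w)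
    (h0 : fderiv ℝ g 0 = 0) : IsNormalOn g U := by
  intro ξ hξ t ht
  have hd : deriv (fun t : ℝ => t • ξ) = fun _ => ξ := by
    funext s
    simpa using ((hasDerivAt_id s).smul_const ξ).deriv
  simp only [hd, deriv_const, zero_add]
  rcases eq_or_ne t 0 with rfl | ht0
  -- At the origin the radial identity is vacuous, so `Dg_0 = 0` is used instead; for `t ≠ 0` the
  -- factor `t ^ 2` is divided out.
  · simp [christoffel, h0]
  · have hmem : t • ξ ∈ U := hU.smul_mem hξ ht.1 ht.2
    have h := hg.christoffel_self hg₀ hnorm hmem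
    rw [← christoffelL_apply, map_smul, map_smul, smul_apply, smul_smul] at h
    exact (smul_eq_zero.1 h).resolve_left (mul_ne_zero ht0 ht0)

/-! ### Realization of algebraic curvature jets -/

lemma exists_isRegular {g : V → V →L[ℝ] V →L[ℝ] ℝ} (hs : ContDiff ℝ ∞ g)
    (hsymm : ∀ p x y, g p x y = g p y x) (h0 : (g 0).IsInvertible) :
    ∃ r > 0, IsRegular g (Metric.ball 0 r) := by
  obtain ⟨r, hr, h⟩ := Metric.eventually_nhds_iff_ball.1
    (hs.continuous.continuousAt.eventually (eventually_isInvertible h0))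
  exact ⟨r, hr, Metric.isOpen_ball, hs, hsymm, h⟩

lemma IsRegular.mono {g : V → V →L[ℝ] V →L[ℝ] ℝ} {U U' : Set V} (hg : IsRegular g U)
    (hU : IsOpen U') (h : U' ⊆ U) : IsRegular g U' :=
  ⟨hU, hg.smooth, hg.symm, fun p hp => hg.inv p (h hp)⟩

/-- The difference between an algebraic curvature jet and the jet of a metric realizing it to
lower order. -/
lemma IsAlgCurvatureJet.isSymmetricJet_sub {g₀ : V →L[ℝ] V →L[ℝ] ℝ} {k : ℕ} {J : TensorSeq V}
    (hJ : IsAlgCurvatureJet g₀ k J) {m : ℕ} (hm : m ≤ k) {g : V → V →L[ℝ] V →L[ℝ] ℝ} {U : Set V}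
    (hg : IsRegular g U) (h0 : (0 : V) ∈ U) (hg0 : g 0 = g₀)
    (hlow : ∀ a : List V, a.length < m → jetField g 0 a = J.toListTensor a) :
    IsSymmetricJet m fun a y₁ y₂ y₃ y₄ =>
      J.toListTensor a y₁ y₂ y₃ y₄ - jetField g 0 a y₁ y₂ y₃ y₄ where
  multi n := by
    refine ((J.multiAt n).add (hg.multiAt_jetField h0 n).neg).congr fun Q _ => ?_
    match Q with
    | [] => simp [flatten]
    | [_] => simp [flatten]
    | [_, _] => simp [flatten]
    | [_, _, _] => simp [flatten]
    | _ :: _ :: _ :: _ :: _ => exact (sub_eq_add_neg _ _).symm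
  curvature c hc := by
    have h1 := hJ.curvature c (hc.trans_le hm)
    have h2 := hg.isAlgCurvature_jetField m 0 h0 c hc
    constructor
    · intro x₁ x₂ y₁ y₂
      linarith [h1.skew x₁ x₂ y₁ y₂, h2.skew x₁ x₂ y₁ y₂]
    · intro x₁ x₂ y₁ y₂
      linarith [h1.pair_symm x₁ x₂ y₁ y₂, h2.pair_symm x₁ x₂ y₁ y₂]
    · intro x₁ x₂ x₃ y
      linarith [h1.bianchi₁ x₁ x₂ x₃ y, h2.bianchi₁ x₁ x₂ x₃ y]
  bianchi₂ c hc x₁ x₂ x₃ y₁ y₂ := by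
    have h1 := (hJ.covDerivative c (hc.trans_le hm)).bianchi₂ x₁ x₂ x₃ y₁ y₂
    have h2 := hg.bianchi_jetField c.length 0 h0 c rfl x₁ x₂ x₃ y₁ y₂
    linarith
  swap a x y c hc := by
    funext y₁ y₂ y₃ y₄
    have h1 := hJ.ricci a x y c (hc.trans_le hm) y₁ y₂ y₃ y₄
    have h2 := hg.ricci_jetField a.length 0 h0 a rfl x y c y₁ y₂ y₃ y₄
    -- The two Ricci right-hand sides involve only orders up to `m - 2`, where the jets agree, so
    -- they cancel in the difference.
    have h3 : leibniz (nablaCurvatureOp g 0 x y) (jetField g 0) a c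
        = leibniz (curvatureEndo g₀ J x y) J.toListTensor a c := by
      refine leibniz_congr a c (fun P hP => ?_) fun Q hQ => hlow Q (by omega)
      funext u
      rw [nablaCurvatureOp, curvatureEndo, hg0]
      congr 1
      ext w
      rw [dualOf_apply (hg.isLinearMap_jetField h0 P x y u), hlow P (by omega)]
      rfl
    rw [h3] at h2
    linarith

/-- The induction on the order, carrying along the gauge condition and `Dg_0 = 0`. The bilinear
forms are smooth and symmetric on all of `V`; nondegeneracy is required only at `0`, and holds
nearby by openness. -/
lemma IsAlgCurvatureJet.exists_metric {g₀ : V →L[ℝ] V →L[ℝ] ℝ} (hg₀ : IsScalarProduct g₀)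
    {k : ℕ} {J : TensorSeq V} (hJ : IsAlgCurvatureJet g₀ k J) (m : ℕ) (hm : m ≤ k + 1) :
    ∃ g : V → V →L[ℝ] V →L[ℝ] ℝ, ContDiff ℝ ∞ g ∧ (∀ p x y, g p x y = g p y x) ∧ g 0 = g₀ ∧
      (∀ p w, g p p w = g₀ p w) ∧ fderiv ℝ g 0 = 0 ∧
      ∀ a : List V, a.length < m → jetField g 0 a = J.toListTensor a := by
  induction m with
  | zero =>
    exact ⟨fun _ => g₀, contDiff_const, fun _ => hg₀.symm, rfl, fun _ _ => rfl, by simp,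
      fun a ha => absurd ha (Nat.not_lt_zero _)⟩
  | succ m ih =>
    obtain ⟨g, hs, hsymm, hg0, hnorm, hd, hlow⟩ := ih (by omega)
    have hinv : (g 0).IsInvertible := hg0 ▸ hg₀.isInvertible
    obtain ⟨r, hr, hg⟩ := exists_isRegular hs hsymm hinv
    obtain ⟨h, hhs, hhsymm, hhnorm, hflat, hlead⟩ :=
      (hJ.isSymmetricJet_sub (by omega) hg (Metric.mem_ball_self hr) hg0 hlow).exists_perturbation
    have hh0 : h 0 = 0 := by
      ext y z
      exact (hflat univ isOpen_univ trivial y z).2.1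
    have hs' : ContDiff ℝ ∞ fun p => g p + h p := hs.add hhs
    have hsymm' : ∀ p x y, (g p + h p) x y = (g p + h p) y x := fun p x y => by
      simp [hsymm p x y, hhsymm p x y]
    obtain ⟨r', hr', hg'⟩ := exists_isRegular hs' hsymm' (by simpa [hh0] using hinv)
    refine ⟨fun p => g p + h p, hs', hsymm', by simp [hh0, hg0], fun p w => by
      simp [hnorm, hhnorm], ?_, fun a ha => ?_⟩
    · rw [fderiv_fun_add (hs.differentiable (by simp) 0) (hhs.differentiable (by simp) 0), hd,
        zero_add]
      ext v y z
      rw [fderiv_apply_apply hhs]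
      exact ((hflat univ isOpen_univ trivial y z).2.2 v).2.1
    · have hU : IsOpen (Metric.ball (0 : V) r ∩ Metric.ball 0 r') :=
        Metric.isOpen_ball.inter Metric.isOpen_ball
      have h0 : (0 : V) ∈ Metric.ball (0 : V) r ∩ Metric.ball 0 r' :=
        ⟨Metric.mem_ball_self hr, Metric.mem_ball_self hr'⟩
      have hfl := hflat _ hU h0
      funext y₁ y₂ y₃ y₄
      have hE := ((hg.mono hU inter_subset_left).flat_jetField_sub (hg'.mono hU inter_subset_right)
        h0 hhs hfl a.length (m - a.length) (by omega) a rfl y₁ y₂ y₃ y₄).2.1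
      -- Below order `m` the linearized curvature of `h` has vanishing derivatives and the old jet
      -- persists; at order `m` they supply exactly the missing difference.
      rcases Nat.lt_or_eq_of_le (Nat.lt_succ_iff.1 ha) with hlt | heq
      · have hlin : iterDir (linearizedCurvature h y₁ y₂ y₃ y₄) a 0 = 0 :=
          (Flat.iterDir (m := 1) a ((flat_linearizedCurvature hU h0 hfl y₁ y₂ y₃ y₄).mono
            (by omega))).2.1
        rw [← hlow a hlt]
        linarith
      · have := hlead a heq y₁ y₂ y₃ y₄
        linarith

end

end CurvatureJet

end

theorem mainTheorem6 {V : Type*} [NormedAddCommGroup V] [NormedSpace ℝ V] [FiniteDimensional ℝ V]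
    (g₀ : V →L[ℝ] V →L[ℝ] ℝ) (hg₀ : IsScalarProduct g₀)
    (k : ℕ) (J : TensorSeq V) (hJ : IsAlgCurvatureJet g₀ k J) :
    ∃ (U : Set V) (g : V → V →L[ℝ] V →L[ℝ] ℝ),
      IsOpen U ∧ (0 : V) ∈ U ∧ StarConvex ℝ 0 U ∧
      IsMetricOn g U ∧ g 0 = g₀ ∧ IsNormalOn g U ∧
      ∀ a : List V, a.length ≤ k → ∀ y₁ y₂ y₃ y₄ : V,
        nablaRiemann g a.length 0 a y₁ y₂ y₃ y₄ = J.eval a y₁ y₂ y₃ y₄ := by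
  -- The bound in the induction is strict, so `k + 1` covers all orders up to `k`.
  obtain ⟨g, hs, hsymm, hg0, hnorm, hd, hjet⟩ := hJ.exists_metric hg₀ (k + 1) le_rfl
  obtain ⟨r, hr, hg⟩ := exists_isRegular hs hsymm (hg0 ▸ hg₀.isInvertible)
  have hstar : StarConvex ℝ 0 (Metric.ball (0 : V) r) :=
    (convex_ball 0 r).starConvex (Metric.mem_ball_self hr)
  refine ⟨Metric.ball 0 r, g, Metric.isOpen_ball, Metric.mem_ball_self hr, hstar,
    ⟨hs.contDiffOn, fun p hp => isScalarProduct_of_isInvertible (hsymm p) (hg.inv p hp)⟩, hg0,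
    hg.isNormalOn hg₀ hstar hnorm hd, fun a ha y₁ y₂ y₃ y₄ => ?_⟩
  exact congrFun (congrFun (congrFun (congrFun (hjet a (Nat.lt_succ_of_le ha)) y₁) y₂) y₃) y₄
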